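/- Let $G=(V,E)$ be a graph on $V=\{0,\dots,n-1\}$. The correlation clustering cost of a partition of $V$ is the number of edges of $G$ between different clusters plus the number of non-adjacent pairs of distinct vertices inside clusters; $\mathrm{opt}(G)$ denotes the minimum cost. In the streaming model $n$ is known, and the edges of $G$ arrive one by one, in arbitrary order; the algorithm may pass over the stream several times and outputs a cluster label for every vertex at the end. The algorithm $r$-Pivot draws a uniformly random permutation $\pi$ of $V$, and starts with all vertices unsettled. In each of $r$ rounds, every unsettled $v$ with $\pi(v)<\pi(u)$ for all unsettled neighbors $u$ of $v$ is marked as a pivot, and then all pivots and all their neighbors are marked as settled. Finally every pivot starts a cluster containing itself; a non-pivot $u$ forms a singleton cluster if there is no pivot in $N(u)$ or if some unsettled $w\in N(u)$ has smaller rank than all pivots in $N(u)$, and otherwise joins the cluster of the minimum rank pivot in $N(u)$. There is an absolute constant $C$ such that for every $\varepsilon>0$ there are an integer $r\ge 1$ and a randomized streaming algorithm (one program for all $n$ and all graphs) with the following properties. 1. It makes exactly $2r+1$ passes over the stream, and $2r+1\le C\max(1,1/\varepsilon)$. 2. On graphs with $n\ge 2$ vertices it uses at most $C\,n\log n$ bits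 of space. 3. It simulates each round of $r$-Pivot in two passes and forms the clusters in one final pass: its memory after the initialization determines a uniformly random permutation $\pi$; for every $t\le r$, its memory after $2t$ passes determines $\pi$ together with the set of unsettled vertices and the set of pivots of $r$-Pivot on $\pi$ after $t$ rounds; and its output after $2r+1$ passes is the clustering of $r$-Pivot on $\pi$. 4. For every graph $G$ and every order of its edges in the stream, the expected cost of the output, over the random choices of the algorithm, is at most $(3+\varepsilon)\,\mathrm{opt}(G)$. -/

import Mathlib

noncomputable section

namespace CorrClust

/-! Correlation clustering: a clustering of `V` is a partition, given as a `Setoid V`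
(`c u v` means that `u` and `v` lie in the same cluster). -/

/-- The number of disagreements of the clustering `c` with the graph `G`: edges between different
clusters plus non-adjacent pairs of distinct vertices inside a cluster. Pairs are unordered. -/
def cost {V : Type*} (G : SimpleGraph V) (c : Setoid V) : ℕ :=
  Set.ncard {e : Sym2 V | ∃ u v, e = s(u, v) ∧ G.Adj u v ∧ ¬ c u v} +
  Set.ncard {e : Sym2 V | ∃ u v, e = s(u, v) ∧ u ≠ v ∧ ¬ G.Adj u v ∧ c u v}

/-- The optimal correlation clustering cost. -/
def opt {V : Type*} (G : SimpleGraph V) : ℕ := ⨅ c : Setoid V, cost G c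

/-! The truncated parallel Pivot algorithm with `r` rounds, run on a fixed permutation `π`;
`π v` is the rank of `v`. -/

/-- The unsettled vertices and the pivots found so far. -/
@[ext] structure PivotState (n : ℕ) where
  unsettled : Set (Fin n)
  pivots : Set (Fin n)

/-- The vertices that become pivots in the next round: the unsettled vertices whose rank is smaller
than that of all their unsettled neighbours. -/
def newPivots {n : ℕ} (G : SimpleGraph (Fin n)) (π : Equiv.Perm (Fin n)) (s : PivotState n) :
    Set (Fin n) :=
  {v | v ∈ s.unsettled ∧ ∀ u ∈ s.unsettled, G.Adj v u → π v < π u}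

/-- One round: mark the new pivots, then settle them and all their neighbours. -/
def pivotRound {n : ℕ} (G : SimpleGraph (Fin n)) (π : Equiv.Perm (Fin n)) (s : PivotState n) :
    PivotState n where
  unsettled := {v | v ∈ s.unsettled ∧ v ∉ newPivots G π s ∧ ∀ p ∈ newPivots G π s, ¬ G.Adj p v}
  pivots := s.pivots ∪ newPivots G π s

/-- The state after `t` rounds; initially every vertex is unsettled and there are no pivots. -/
def pivotState {n : ℕ} (G : SimpleGraph (Fin n)) (π : Equiv.Perm (Fin n)) (t : ℕ) :
    PivotState n :=
  (pivotRound G π)^[t] ⟨Set.univ, ∅⟩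

/-- The non-pivot `u` joins the cluster of `v`: `v` is the minimum rank pivot in `N(u)`, and no
unsettled vertex of `N(u)` has smaller rank than all the pivots in `N(u)`. -/
def Joins {n : ℕ} (G : SimpleGraph (Fin n)) (π : Equiv.Perm (Fin n)) (s : PivotState n)
    (u v : Fin n) : Prop :=
  u ∉ s.pivots ∧ v ∈ s.pivots ∧ G.Adj u v ∧ (∀ p ∈ s.pivots, G.Adj u p → π v ≤ π p) ∧
    ¬ ∃ w ∈ s.unsettled, G.Adj u w ∧ ∀ p ∈ s.pivots, G.Adj u p → π w < π p

open Classical in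
/-- The vertex that started the cluster of `u`: the pivot that `u` joins (it is unique), and `u`
itself if `u` is a pivot or forms a singleton cluster. -/
def clusterHead {n : ℕ} (G : SimpleGraph (Fin n)) (π : Equiv.Perm (Fin n)) (s : PivotState n)
    (u : Fin n) : Fin n :=
  if h : ∃ v, Joins G π s u v then h.choose else u

/-- The clustering returned by the `r`-round algorithm on the permutation `π`. -/
def rPivot {n : ℕ} (r : ℕ) (G : SimpleGraph (Fin n)) (π : Equiv.Perm (Fin n)) : Setoid (Fin n) :=
  Setoid.ker (clusterHead G π (pivotState G π r))

/-! Randomized graph streaming algorithms. The memory consists of `S` cells of `w` bits. -/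

/-- A memory of `S` cells, each holding a word of `w` bits. -/
abbrev Mem (S w : ℕ) := Fin S → Fin (2 ^ w)

/-- The content of cell `a` (`0` if there is no such cell). -/
def Mem.get {S w : ℕ} (m : Mem S w) (a : ℕ) : ℕ := if h : a < S then (m ⟨a, h⟩ : ℕ) else 0

/-- Write `x`, reduced to `w` bits, to cell `a` (no effect if there is no such cell). -/
def Mem.set {S w : ℕ} (m : Mem S w) (a x : ℕ) : Mem S w :=
  fun i => if (i : ℕ) = a then ⟨x % 2 ^ w, Nat.mod_lt _ (Nat.two_pow_pos w)⟩ else m i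

/-- Word expressions. `order` is the number of vertices; `src` and `dst` are the two ends of the
edge that has just arrived. -/
inductive Expr where
  | lit (k : ℕ)
  | order
  | src
  | dst
  | read (a : Expr)
  | add (x y : Expr)
  | sub (x y : Expr)
  | mul (x y : Expr)
  | lt (x y : Expr)
  | eq (x y : Expr)

/-- The value of an expression; every intermediate result is reduced to `w` bits, subtraction is
truncated at `0`, and comparisons give `1` or `0`. -/
def Expr.eval {S w : ℕ} (n u v : ℕ) (m : Mem S w) : Expr → ℕ
  | lit k => k % 2 ^ w
  | order => n % 2 ^ w
  | src => u % 2 ^ w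
  | dst => v % 2 ^ w
  | read a => m.get (a.eval n u v m)
  | add x y => (x.eval n u v m + y.eval n u v m) % 2 ^ w
  | sub x y => x.eval n u v m - y.eval n u v m
  | mul x y => (x.eval n u v m * y.eval n u v m) % 2 ^ w
  | lt x y => (if x.eval n u v m < y.eval n u v m then 1 else 0) % 2 ^ w
  | eq x y => (if x.eval n u v m = y.eval n u v m then 1 else 0) % 2 ^ w

/-- The number of nodes: a bound on the number of words needed to evaluate the expression. -/
def Expr.words : Expr → ℕ
  | lit _ | order | src | dst => 1
  | read a => a.words + 1
  | add x y | sub x y | mul x y | lt x y | eq x y => x.words + y.words + 1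

/-- Randomized programs. `store a x` writes `x` to cell `a`; `draw a k` writes a fresh uniformly
random element of `{0, …, k}` to cell `a`; `ite x c d` executes `c` if `x` is nonzero and `d`
otherwise; `loop a k c` executes `c` for each `i = 0, …, k - 1` in this order, after writing `i` to
cell `a` (`a` and `k` are evaluated once, at the beginning). -/
inductive Cmd where
  | skip
  | store (a x : Expr)
  | draw (a k : Expr)
  | seq (c d : Cmd)
  | ite (x : Expr) (c d : Cmd)
  | loop (a k : Expr) (c : Cmd)

/-- The law of the memory after executing a program on the memory `m`. -/
def Cmd.run {S w : ℕ} (n u v : ℕ) : Cmd → Mem S w → PMF (Mem S w)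
  | skip, m => PMF.pure m
  | store a x, m => PMF.pure (m.set (a.eval n u v m) (x.eval n u v m))
  | draw a k, m => (PMF.uniformOfFintype (Fin (k.eval n u v m + 1))).map
      fun i => m.set (a.eval n u v m) i
  | seq c d, m => (c.run n u v m).bind fun m' => d.run n u v m'
  | ite x c d, m => if x.eval n u v m ≠ 0 then c.run n u v m else d.run n u v m
  | loop a k c, m => (List.range (k.eval n u v m)).foldl
      (fun p i => p.bind fun m' => c.run n u v (m'.set (a.eval n u v m) i)) (PMF.pure m)

/-- The number of additional words used while the program is executed: the temporaries in the
evaluation of expressions and, for each loop under way, its counter, its bound and the address of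
its cell. -/
def Cmd.words : Cmd → ℕ
  | skip => 0
  | store a x => a.words + x.words
  | draw a k => a.words + k.words
  | seq c d => max c.words d.words
  | ite x c d => max x.words (max c.words d.words)
  | loop a k c => max (a.words + k.words) (c.words + 3)

/-- One pass over the stream: `onEdge` is executed whenever an edge arrives, `atEnd` once after the
last edge. -/
structure Pass where
  onEdge : Cmd
  atEnd : Cmd

/-- A randomized multi-pass streaming algorithm. It is one program for all graphs. On graphs with
`n` vertices it has `perVertex * n + extra` cells of `width * Nat.size n` bits each, where
`Nat.size n` is the length of the binary representation of `n`. It executes `init` before reading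
the stream, and then makes the passes listed in `passes`. -/
structure StreamAlg where
  perVertex : ℕ
  extra : ℕ
  width : ℕ
  init : Cmd
  passes : List Pass

namespace StreamAlg

variable (A : StreamAlg)

/-- The number of memory cells on graphs with `n` vertices. -/
def cells (n : ℕ) : ℕ := A.perVertex * n + A.extra

/-- The word length on graphs with `n` vertices. -/
def wordBits (n : ℕ) : ℕ := A.width * Nat.size n

/-- The memory configurations on graphs with `n` vertices. -/
abbrev Memory (n : ℕ) := Mem (A.cells n) (A.wordBits n)

/-- The number of additional words used by the programs of the algorithm. -/
def words : ℕ :=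
  max A.init.words ((A.passes.map fun P => max P.onEdge.words P.atEnd.words).foldr max 0)

/-- The space in bits: the memory cells, the three words that hold the number of vertices and the
current edge, and the additional words used in executing the programs. -/
def space (n : ℕ) : ℕ := (A.cells n + 3 + A.words) * A.wordBits n

/-- The law of the memory after the initialization; all cells are `0` at the beginning. -/
def start (n : ℕ) : PMF (A.Memory n) :=
  A.init.run n 0 0 fun _ => ⟨0, Nat.two_pow_pos _⟩

/-- The law of the memory after one pass over the stream `l`, begun with the memory `m`. -/
def runPass (n : ℕ) (l : List (Fin n × Fin n)) (P : Pass) (m : A.Memory n) : PMF (A.Memory n) :=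
  (l.foldl (fun p e => p.bind fun m' => P.onEdge.run n e.1 e.2 m') (PMF.pure m)).bind
    fun m' => P.atEnd.run n 0 0 m'

/-- The law of the memory after the first `k` passes (all of them, if there are fewer than `k`)
over the stream `l`, begun with the memory `m`. -/
def runPasses (n : ℕ) (l : List (Fin n × Fin n)) (k : ℕ) (m : A.Memory n) : PMF (A.Memory n) :=
  (A.passes.take k).foldl (fun p P => p.bind fun m' => A.runPass n l P m') (PMF.pure m)

/-- The law of the memory at the end of the computation on the stream `l`. -/
def run (n : ℕ) (l : List (Fin n × Fin n)) : PMF (A.Memory n) :=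
  (A.start n).bind fun m => A.runPasses n l A.passes.length m

/-- The clustering output with the final memory `m`: cell `v` holds the cluster label of vertex `v`,
for `v = 0, …, n - 1`. -/
def output {n : ℕ} (m : A.Memory n) : Setoid (Fin n) := Setoid.ker fun v : Fin n => m.get v

end StreamAlg

/-- `l` is a stream of the edges of `G`: every edge occurs exactly once, the order of the edges and
the order of the two ends of each edge being arbitrary. -/
def IsStream {n : ℕ} (G : SimpleGraph (Fin n)) (l : List (Fin n × Fin n)) : Prop :=
  (l.map fun e => s(e.1, e.2)).Nodup ∧
    ∀ e : Sym2 (Fin n), e ∈ l.map (fun e => s(e.1, e.2)) ↔ e ∈ G.edgeSet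

/-- The expected cost of the clustering that `A` outputs on the stream `l` of the graph `G`. -/
def expectedCost (A : StreamAlg) {n : ℕ} (G : SimpleGraph (Fin n)) (l : List (Fin n × Fin n)) : ℝ :=
  ∑ m : A.Memory n, (A.run n l m).toReal * (cost G (A.output m) : ℝ)

/-- `A` simulates each round of the `r`-round truncated Pivot algorithm in two passes and forms its
clusters in one final pass: the memory after the initialization determines a uniformly random
permutation `π`; for each `t ≤ r`, the memory after `2 t` passes determines `π` and the
state of the algorithm (unsettled vertices and pivots) on `π` after `t` rounds; and
after `2 r + 1` passes, the last ones, the output is the clustering of the algorithm on `π`.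
What a memory configuration stands for depends neither on the graph nor on the stream nor
on `t`. -/
def SimulatesRPivot (A : StreamAlg) (r : ℕ) : Prop :=
  A.passes.length = 2 * r + 1 ∧
  ∀ n : ℕ, ∃ decode : A.Memory n → Equiv.Perm (Fin n) × PivotState n,
    (A.start n).map (fun m => (decode m).1) = PMF.uniformOfFintype (Equiv.Perm (Fin n)) ∧
    ∀ (G : SimpleGraph (Fin n)) (l : List (Fin n × Fin n)), IsStream G l →
      ∀ m₀ ∈ (A.start n).support,
        (∀ t ≤ r, ∀ m ∈ (A.runPasses n l (2 * t) m₀).support,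
          decode m = ((decode m₀).1, pivotState G (decode m₀).1 t)) ∧
        ∀ m ∈ (A.runPasses n l (2 * r + 1) m₀).support,
          A.output m = rPivot r G (decode m₀).1

end CorrClust

end

/-!
The algorithm is the direct streaming implementation of `r`-Pivot with `r = ⌈6 / ε⌉`. The work is in
the bound on the cost, which compares the truncated algorithm with the sequential Pivot algorithm;
`head G π u` is the pivot whose cluster contains `u` in the latter.

*Sequential Pivot is a 3-approximation* (`sum_cost_pivot_le`). Every error of Pivot is made on a
pair `u v` of a bad triangle `p u v` (two edges, one non-edge) that is hit by its third vertex `p`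
while all three vertices are undominated. Exchanging the ranks of `p` and `u` shows that the three
vertices of a triangle are equally likely to hit it, and a given pair is exposed by at most one hit.
Since every clustering errs on some pair of each bad triangle, the expected number of hits is at
most three times its cost.

*Truncation after `r` rounds costs an extra fraction `2 / r`* (`mul_sum_cost_rPivot_le`). The
truncated clustering refines that of Pivot, so it only cuts additional edges `u v` inside a cluster
of Pivot. The reason is always a vertex that is unsettled after `r` rounds, and this yields a chain
of `r` links `a b`, with decreasing ranks: `a` is undominated up to the rank of its neighbour `b`,
`b` is captured by its pivot `a'`, and the next link is `a' b'` with a neighbour `b'` of `a'` that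
made `a'` wait. Each link is an edge cut by Pivot. Given a link of the chain, the permutation is
changed by exchanging, from the top of the chain down to this link, the ranks of `a'` and `a` and
those of `b'` and `b`. Ranks below `b'` are not affected, so the link is cut under the new
permutation as well. Moreover `b` is now the pivot of `a'`, and once this exchange is undone, `a` is
the pivot of `b`; so the exchanges can be undone one by one knowing only the last link
(`Link.extend`). At the top of the chain the edge `u v` is encoded in the same way; this case is
recognized because there the vertex found instead of `a` is equal or adjacent to the first vertex of
the link, whereas `a` is not adjacent to the pivot `a'`. Hence pairs of an additional cut edge and
one of its `r` links inject into pairs of a permutation and an edge cut by Pivot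
(`card_mul_le_card_cut`), for each of the two ways in which `u` can be late.

*The streaming algorithm* draws the ranks by a Fisher-Yates shuffle (`initCmd_run`). After that it
is deterministic, and each pass is verified with an invariant on the part of the stream already read
(`surely_round`, `surely_output`).
-/

namespace CorrClust

/-! ### The sequential Pivot algorithm -/

section Pivot

variable {n : ℕ} {G : SimpleGraph (Fin n)} {π σ : Equiv.Perm (Fin n)} {u v p q : Fin n}

/-- The pivots of the sequential Pivot algorithm: `v` is a pivot iff no neighbour of smaller rank
is one. -/
def IsPivot (G : SimpleGraph (Fin n)) (π : Equiv.Perm (Fin n)) (v : Fin n) : Prop :=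
  ∀ u, G.Adj v u → (h : π u < π v) → ¬ IsPivot G π u
termination_by π v
decreasing_by exact h

theorem isPivot_iff : IsPivot G π v ↔ ∀ u, G.Adj v u → π u < π v → ¬ IsPivot G π u := by
  rw [IsPivot]

theorem IsPivot.not_adj (hu : IsPivot G π u) (hv : IsPivot G π v) : ¬ G.Adj u v := by
  intro h
  rcases lt_trichotomy (π u) (π v) with h1 | h1 | h1
  · exact isPivot_iff.1 hv u h.symm h1 hu
  · exact h.ne (π.injective h1)
  · exact isPivot_iff.1 hu v h h1 hv

/-- No pivot of rank less than `k` is a neighbour of `v`. -/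
def Free (G : SimpleGraph (Fin n)) (π : Equiv.Perm (Fin n)) (k v : Fin n) : Prop :=
  ∀ p, IsPivot G π p → π p < k → ¬ G.Adj v p

theorem Free.mono {k l : Fin n} (h : Free G π k v) (hl : l ≤ k) : Free G π l v :=
  fun p hp hpl => h p hp (hpl.trans_le hl)

theorem Free.isPivot (h : Free G π (π v) v) : IsPivot G π v :=
  isPivot_iff.2 fun u hu hlt hp => h u hp hlt hu

theorem IsPivot.free {k : Fin n} (h : IsPivot G π v) : Free G π k v :=
  fun _ hp _ => h.not_adj hp

/-- The vertices of rank less than `k` are the same for `π` and for `σ`, with the same ranks. -/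
def AgreeBelow (k : Fin n) (π σ : Equiv.Perm (Fin n)) : Prop := ∀ v, π v < k → σ v = π v

theorem AgreeBelow.symm {k : Fin n} (h : AgreeBelow k π σ) : AgreeBelow k σ π := by
  intro v hv
  have h1 : π (π.symm (σ v)) = σ v := π.apply_symm_apply _
  have h2 := h (π.symm (σ v)) (by rwa [h1])
  rw [h1] at h2
  rw [← σ.injective h2, h1, σ.injective h2]

theorem AgreeBelow.mono {k l : Fin n} (h : AgreeBelow k π σ) (hl : l ≤ k) : AgreeBelow l π σ :=
  fun v hv => h v (hv.trans_le hl)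

theorem AgreeBelow.le {k : Fin n} (h : AgreeBelow k π σ) (hv : k ≤ π v) : k ≤ σ v := by
  by_contra hlt
  have := h.symm v (not_le.1 hlt)
  rw [← this] at hlt
  exact hlt hv

/-- Exchanging the ranks of two vertices does not affect the ranks below both of them. -/
theorem AgreeBelow.mul_swap {k : Fin n} (h : AgreeBelow k π σ) (hu : k ≤ π u) (hv : k ≤ π v) :
    AgreeBelow k π (σ * Equiv.swap u v) := by
  intro x hx
  have h1 : x ≠ u := by rintro rfl; exact absurd hx (not_lt.2 hu)
  have h2 : x ≠ v := by rintro rfl; exact absurd hx (not_lt.2 hv)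
  rw [Equiv.Perm.mul_apply, Equiv.swap_apply_of_ne_of_ne h1 h2, h x hx]

theorem AgreeBelow.refl (k : Fin n) (π : Equiv.Perm (Fin n)) : AgreeBelow k π π := fun _ _ => rfl

theorem AgreeBelow.isPivot {k : Fin n} (h : AgreeBelow k π σ) (hv : π v < k) :
    IsPivot G π v ↔ IsPivot G σ v := by
  induction hm : π v using WellFoundedLT.induction generalizing v with
  | ind m ih =>
    subst hm
    rw [isPivot_iff, isPivot_iff]
    have hs := h v hv
    constructor
    · intro hp u hu hlt
      rw [hs] at hlt
      have e := h.symm u (hlt.trans hv)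
      rw [← e] at hlt
      rw [← ih _ hlt (hlt.trans hv) rfl]
      exact hp u hu hlt
    · intro hp u hu hlt
      rw [ih _ hlt (hlt.trans hv) rfl]
      apply hp u hu
      rwa [hs, h u (hlt.trans hv)]

theorem AgreeBelow.free {k : Fin n} (h : AgreeBelow k π σ) (hf : Free G π k v) :
    Free G σ k v := by
  intro p hp hlt
  have e := h.symm p hlt
  exact hf p ((h.symm.isPivot hlt).1 hp) (by rwa [e])

theorem exists_head (G : SimpleGraph (Fin n)) (π : Equiv.Perm (Fin n)) (u : Fin n) :
    ∃ p, (IsPivot G π p ∧ (p = u ∨ G.Adj u p)) ∧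
      ∀ q, IsPivot G π q → (q = u ∨ G.Adj u q) → π p ≤ π q := by
  classical
  have hne : (Finset.univ.filter fun p => IsPivot G π p ∧ (p = u ∨ G.Adj u p)).Nonempty := by
    by_cases hu : IsPivot G π u
    · exact ⟨u, by simp [hu]⟩
    · rw [isPivot_iff] at hu
      push Not at hu
      obtain ⟨p, h1, -, h2⟩ := hu
      exact ⟨p, by simp [h1, h2]⟩
  obtain ⟨p, hp, hmin⟩ := Finset.exists_min_image _ π hne
  exact ⟨p, by simpa using hp, fun q h1 h2 => hmin q (by simp [h1, h2])⟩

/-- The pivot whose cluster contains `u` in the sequential Pivot algorithm: the pivot of minimum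
rank among `u` and its neighbours. -/
noncomputable def head (G : SimpleGraph (Fin n)) (π : Equiv.Perm (Fin n)) (u : Fin n) : Fin n :=
  (exists_head G π u).choose

theorem isPivot_head : IsPivot G π (head G π u) := (exists_head G π u).choose_spec.1.1

theorem head_eq_or_adj : head G π u = u ∨ G.Adj u (head G π u) :=
  (exists_head G π u).choose_spec.1.2

theorem head_le (hq : IsPivot G π q) (h : q = u ∨ G.Adj u q) : π (head G π u) ≤ π q :=
  (exists_head G π u).choose_spec.2 q hq h

theorem head_unique (hp : IsPivot G π p) (h : p = u ∨ G.Adj u p)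
    (hmin : ∀ q, IsPivot G π q → (q = u ∨ G.Adj u q) → π p ≤ π q) : head G π u = p :=
  π.injective (le_antisymm (head_le hp h) (hmin _ isPivot_head head_eq_or_adj))

theorem IsPivot.head_eq (h : IsPivot G π u) : head G π u = u := by
  rcases head_eq_or_adj (G := G) (π := π) (u := u) with h1 | h1
  · exact h1
  · exact absurd h1 (h.not_adj isPivot_head)

theorem head_le_self : π (head G π u) ≤ π u := by
  by_cases h : IsPivot G π u
  · rw [h.head_eq]
  · have h' := h
    rw [isPivot_iff] at h'
    push Not at h'
    obtain ⟨p, h1, h2, h3⟩ := h'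
    exact (head_le h3 (Or.inr h1)).trans h2.le

theorem free_head : Free G π (π (head G π u)) u :=
  fun _ hp hlt h => absurd (head_le hp (Or.inr h)) (not_le.2 hlt)

theorem adj_head (h : head G π u ≠ u) : G.Adj u (head G π u) :=
  head_eq_or_adj.resolve_left h

theorem head_lt (h : ¬ IsPivot G π u) : π (head G π u) < π u :=
  lt_of_le_of_ne head_le_self fun e => h (π.injective e ▸ isPivot_head)

/-- A vertex `h` that is undominated up to its own rank in `σ` captures all its neighbours that are
undominated up to that rank. -/
theorem head_eq_of_free {k h : Fin n} (hag : AgreeBelow k π σ) (hk : σ h = k) (hh : Free G π k h)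
    (hu : Free G π k u) (hadj : G.Adj u h) (hle : k ≤ σ u) : head G σ u = h := by
  subst hk
  refine head_unique (hag.free hh).isPivot (Or.inr hadj) fun q hq hqu => ?_
  rcases hqu with rfl | hqu
  · exact hle
  · by_contra hlt
    exact hag.free hu q hq (not_le.1 hlt) hqu

end Pivot

/-! ### The cost as a sum over ordered pairs -/

section Cost

variable {n : ℕ} {G : SimpleGraph (Fin n)}

/-- The clustering `c` errs on the pair `u`, `v` of distinct vertices. -/
def Errs (G : SimpleGraph (Fin n)) (c : Setoid (Fin n)) (u v : Fin n) : Prop :=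
  u ≠ v ∧ (G.Adj u v ↔ ¬ c u v)

open Classical in
theorem two_mul_ncard_pairs {R : Fin n → Fin n → Prop} (hs : ∀ u v, R u v → R v u)
    (hi : ∀ u, ¬ R u u) :
    2 * Set.ncard {e : Sym2 (Fin n) | ∃ u v, e = s(u, v) ∧ R u v} =
      ∑ u, ∑ v, if R u v then 1 else 0 := by
  let H : SimpleGraph (Fin n) := ⟨R, ⟨fun u v h => hs u v h⟩, ⟨fun u h => hi u h⟩⟩
  have h1 : {e : Sym2 (Fin n) | ∃ u v, e = s(u, v) ∧ R u v} = H.edgeSet := by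
    ext e
    constructor
    · rintro ⟨u, v, rfl, h⟩
      exact h
    · induction e with
      | h u v => exact fun h => ⟨u, v, rfl, h⟩
  rw [h1, ← SimpleGraph.coe_edgeFinset, Set.ncard_coe_finset, ← H.sum_degrees_eq_twice_card_edges]
  refine Finset.sum_congr rfl fun u _ => ?_
  rw [← H.card_neighborFinset_eq_degree, ← Finset.sum_filter, Finset.sum_const, smul_eq_mul,
    mul_one]
  congr 1
  ext v
  simp [H]

open Classical in
theorem two_mul_cost (c : Setoid (Fin n)) :
    2 * cost G c = ∑ u, ∑ v, if Errs G c u v then 1 else 0 := by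
  have hc : ∀ {u v}, c u v → c v u := fun h => c.symm' h
  rw [cost, mul_add, two_mul_ncard_pairs (R := fun u v => G.Adj u v ∧ ¬ c u v)
      (fun u v h => ⟨h.1.symm, fun h' => h.2 (hc h')⟩) (fun u h => h.1.ne rfl),
    two_mul_ncard_pairs (R := fun u v => u ≠ v ∧ ¬ G.Adj u v ∧ c u v)
      (fun u v h => ⟨h.1.symm, fun h' => h.2.1 h'.symm, hc h.2.2⟩) (fun u h => h.1 rfl),
    ← Finset.sum_add_distrib]
  refine Finset.sum_congr rfl fun u _ => ?_
  rw [← Finset.sum_add_distrib]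
  refine Finset.sum_congr rfl fun v _ => ?_
  by_cases h0 : u = v
  · subst h0; simp [Errs]
  · by_cases h1 : G.Adj u v <;> by_cases h2 : c u v <;> simp [Errs, h0, h1, h2]

theorem exists_cost_eq_opt (G : SimpleGraph (Fin n)) : ∃ c : Setoid (Fin n), cost G c = opt G :=
  Nat.sInf_mem (Set.range_nonempty (cost G))

end Cost

/-! ### The sequential Pivot algorithm is a 3-approximation in expectation -/

section ThreeApprox

variable {n : ℕ} {G : SimpleGraph (Fin n)} {π σ : Equiv.Perm (Fin n)} {u v p q : Fin n}

/-- The clustering returned by the sequential Pivot algorithm. -/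
noncomputable def pivotClustering (G : SimpleGraph (Fin n)) (π : Equiv.Perm (Fin n)) :
    Setoid (Fin n) := Setoid.ker (head G π)

/-- Exactly two of the three pairs of the triple are edges. -/
def BadTriangle (G : SimpleGraph (Fin n)) (p u v : Fin n) : Prop :=
  (p ≠ u ∧ p ≠ v ∧ u ≠ v) ∧ ((G.Adj p u ∧ G.Adj p v ∧ ¬ G.Adj u v) ∨
    (G.Adj p u ∧ ¬ G.Adj p v ∧ G.Adj u v) ∨ (¬ G.Adj p u ∧ G.Adj p v ∧ G.Adj u v))

theorem BadTriangle.rotate (h : BadTriangle G p u v) : BadTriangle G u p v := by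
  obtain ⟨⟨h1, h2, h3⟩, h⟩ := h
  refine ⟨⟨h1.symm, h3, h2⟩, ?_⟩
  rw [G.adj_comm u p]
  tauto

theorem BadTriangle.swap (h : BadTriangle G p u v) : BadTriangle G p v u := by
  obtain ⟨⟨h1, h2, h3⟩, h⟩ := h
  refine ⟨⟨h2, h1, h3.symm⟩, ?_⟩
  rw [G.adj_comm v u]
  tauto

/-- The bad triangle `p`, `u`, `v` is hit by `p`: all three vertices are still undominated when it is
the turn of `p`, the first of them. Then Pivot errs on the pair `u`, `v`. -/
structure Hit (G : SimpleGraph (Fin n)) (p u v : Fin n) (π : Equiv.Perm (Fin n)) : Prop where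
  bad : BadTriangle G p u v
  lt_left : π p < π u
  lt_right : π p < π v
  free : Free G π (π p) p
  free_left : Free G π (π p) u
  free_right : Free G π (π p) v

theorem Hit.swap (h : Hit G p u v π) : Hit G p v u π :=
  ⟨h.bad.swap, h.lt_right, h.lt_left, h.free, h.free_right, h.free_left⟩

/-- Exchanging the ranks of `p` and `u` makes `u` the vertex that hits the triangle. -/
theorem Hit.mul_swap (h : Hit G p u v π) : Hit G u p v (π * Equiv.swap p u) := by
  have hag : AgreeBelow (π p) π (π * Equiv.swap p u) :=
    (AgreeBelow.refl _ π).mul_swap le_rfl h.lt_left.le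
  have hu : (π * Equiv.swap p u) u = π p := by simp
  have hp : (π * Equiv.swap p u) p = π u := by simp
  have hv : (π * Equiv.swap p u) v = π v := by
    rw [Equiv.Perm.mul_apply, Equiv.swap_apply_of_ne_of_ne h.bad.1.2.1.symm h.bad.1.2.2.symm]
  refine ⟨h.bad.rotate, ?_, ?_, ?_, ?_, ?_⟩
  · rw [hu, hp]; exact h.lt_left
  · rw [hu, hv]; exact h.lt_right
  all_goals rw [hu]
  · exact hag.free h.free_left
  · exact hag.free h.free
  · exact hag.free h.free_right

theorem Hit.unique (h : Hit G p u v π) (h' : Hit G q u v π) : p = q := by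
  have key : ∀ {p q : Fin n}, Hit G p u v π → Hit G q u v π → ¬ π p < π q := by
    intro p q h h' hlt
    have hp := h.free.isPivot
    rcases h.bad.2 with h1 | h1 | h1
    · exact h'.free_left p hp hlt h1.1.symm
    · exact h'.free_left p hp hlt h1.1.symm
    · exact h'.free_right p hp hlt h1.2.1.symm
  exact π.injective (le_antisymm (not_lt.1 (key h' h)) (not_lt.1 (key h h')))

/-- Every error of Pivot comes from a hit bad triangle. -/
theorem exists_hit_of_errs (h : Errs G (pivotClustering G π) u v) : ∃ p, Hit G p u v π := by
  have cut : ∀ {u v : Fin n}, G.Adj u v → π (head G π u) < π (head G π v) →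
      Hit G (head G π u) u v π := by
    intro u v huv hlt
    have hv : ¬ G.Adj v (head G π u) := fun ha =>
      absurd (head_le isPivot_head (Or.inr ha)) (not_le.2 hlt)
    have hu : head G π u ≠ u := fun e => hv (e.symm ▸ huv.symm)
    have hne : head G π u ≠ v := fun e =>
      absurd (head_le_self (G := G) (π := π) (u := v)) (not_le.2 (e ▸ hlt))
    refine ⟨⟨⟨hu, hne, huv.ne⟩, Or.inr (Or.inl ⟨(adj_head hu).symm, fun ha => hv ha.symm, huv⟩)⟩,
      ?_, hlt.trans_le head_le_self, isPivot_head.free, free_head, free_head.mono hlt.le⟩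
    exact lt_of_le_of_ne head_le_self fun e => hu (π.injective e)
  obtain ⟨hne, h⟩ := h
  change _ ↔ ¬ (head G π u = head G π v) at h
  by_cases huv : G.Adj u v
  · rcases lt_trichotomy (π (head G π u)) (π (head G π v)) with h1 | h1 | h1
    · exact ⟨_, cut huv h1⟩
    · exact absurd (π.injective h1) (h.1 huv)
    · exact ⟨_, (cut huv.symm h1).swap⟩
  · have he : head G π u = head G π v := by tauto
    have hu : head G π u ≠ u := by
      intro e
      rcases head_eq_or_adj (G := G) (π := π) (u := v) with h1 | h1
      · exact hne (by rw [← e, he, h1])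
      · rw [← he, e] at h1; exact huv h1.symm
    have hv : head G π v ≠ v := by
      intro e
      rcases head_eq_or_adj (G := G) (π := π) (u := u) with h1 | h1
      · exact hu h1
      · rw [he, e] at h1; exact huv h1
    have hv' : head G π u ≠ v := he ▸ hv
    have ha := adj_head hv
    rw [← he] at ha
    refine ⟨head G π u, ⟨⟨hu, hv', hne⟩, Or.inl ⟨(adj_head hu).symm, ha.symm, huv⟩⟩, ?_, ?_,
      isPivot_head.free, free_head, he ▸ free_head⟩
    · exact lt_of_le_of_ne head_le_self fun e => hu (π.injective e)
    · exact he ▸ lt_of_le_of_ne head_le_self fun e => hv (π.injective e)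

/-- A clustering errs on some pair of every bad triangle. -/
theorem BadTriangle.errs (h : BadTriangle G p u v) (c : Setoid (Fin n)) :
    Errs G c u v ∨ Errs G c p u ∨ Errs G c p v := by
  obtain ⟨⟨h1, h2, h3⟩, h⟩ := h
  have t1 : c p u → c p v → c u v := fun a b => c.trans' (c.symm' a) b
  have t2 : c p u → c u v → c p v := fun a b => c.trans' a b
  have t3 : c p v → c u v → c p u := fun a b => c.trans' a (c.symm' b)
  simp only [Errs, h1, h2, h3, ne_eq, not_false_eq_true, true_and]
  tauto

open Classical in
/-- The number of permutations for which `p` hits the bad triangle `p`, `u`, `v`. -/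
noncomputable def hits (G : SimpleGraph (Fin n)) (p u v : Fin n) : ℕ :=
  ∑ π : Equiv.Perm (Fin n), if Hit G p u v π then 1 else 0

theorem hits_swap (p u v : Fin n) : hits G p u v = hits G p v u := by
  classical
  exact Finset.sum_congr rfl fun π _ => if_congr ⟨Hit.swap, Hit.swap⟩ rfl rfl

/-- The three vertices of a bad triangle are equally likely to be the one that hits it. -/
theorem hits_rotate (p u v : Fin n) : hits G p u v = hits G u p v := by
  classical
  refine Fintype.sum_equiv (Equiv.mulRight (Equiv.swap p u)) _ _ fun π => ?_
  refine if_congr ⟨Hit.mul_swap, fun h => ?_⟩ rfl rfl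
  have := h.mul_swap
  rwa [Equiv.coe_mulRight, Equiv.swap_comm u p, mul_assoc, Equiv.swap_mul_self, mul_one] at this

theorem sum_hits_le (u v : Fin n) : ∑ p, hits G p u v ≤ n.factorial := by
  classical
  unfold hits
  rw [Finset.sum_comm]
  have h1 : ∀ π : Equiv.Perm (Fin n), ∑ p, (if Hit G p u v π then 1 else 0) ≤ 1 := by
    intro π
    rw [← Finset.card_filter, Finset.card_le_one]
    intro a ha b hb
    simp only [Finset.mem_filter, Finset.mem_univ, true_and] at ha hb
    exact ha.unique hb
  calc _ ≤ ∑ π : Equiv.Perm (Fin n), 1 := Finset.sum_le_sum fun π _ => h1 π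
    _ = n.factorial := by simp [Fintype.card_perm]

theorem two_mul_sum_cost_pivot_le :
    2 * ∑ π : Equiv.Perm (Fin n), cost G (pivotClustering G π) ≤ ∑ p, ∑ u, ∑ v, hits G p u v := by
  classical
  have h1 : ∀ (π : Equiv.Perm (Fin n)) (u v : Fin n),
      (if Errs G (pivotClustering G π) u v then 1 else 0) ≤
        ∑ p, if Hit G p u v π then 1 else 0 := by
    intro π u v
    split_ifs with h
    · obtain ⟨p, hp⟩ := exists_hit_of_errs h
      refine le_trans ?_ (Finset.single_le_sum (fun _ _ => Nat.zero_le _) (Finset.mem_univ p))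
      rw [if_pos hp]
    · exact Nat.zero_le _
  rw [Finset.mul_sum]
  calc _ ≤ ∑ π : Equiv.Perm (Fin n), ∑ u, ∑ v, ∑ p, (if Hit G p u v π then 1 else 0) := by
        refine Finset.sum_le_sum fun π _ => ?_
        rw [two_mul_cost]
        exact Finset.sum_le_sum fun u _ => Finset.sum_le_sum fun v _ => h1 π u v
    _ = ∑ u, ∑ v, ∑ p, hits G p u v := by
        unfold hits
        rw [Finset.sum_comm]
        refine Finset.sum_congr rfl fun u _ => ?_
        rw [Finset.sum_comm]
        refine Finset.sum_congr rfl fun v _ => ?_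
        rw [Finset.sum_comm]
    _ = ∑ u, ∑ p, ∑ v, hits G p u v :=
        Finset.sum_congr rfl fun u _ => Finset.sum_comm
    _ = _ := Finset.sum_comm

/-- The total number of hits is charged to the errors of an arbitrary clustering `c`. -/
theorem sum_hits_le_cost (c : Setoid (Fin n)) :
    ∑ p, ∑ u, ∑ v, hits G p u v ≤ 3 * (n.factorial * (2 * cost G c)) := by
  classical
  let e : Fin n → Fin n → ℕ := fun u v => if Errs G c u v then 1 else 0
  have h1 : ∀ p u v, hits G p u v ≤
      hits G p u v * e u v + hits G p u v * e p u + hits G p u v * e p v := by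
    intro p u v
    by_cases hb : BadTriangle G p u v
    · rcases hb.errs c with h | h | h
      · have : e u v = 1 := if_pos h
        rw [this]; omega
      · have : e p u = 1 := if_pos h
        rw [this]; omega
      · have : e p v = 1 := if_pos h
        rw [this]; omega
    · have h0 : hits G p u v = 0 := Finset.sum_eq_zero fun π _ => if_neg fun h => hb h.bad
      rw [h0]; simp
  have h2 : ∑ p, ∑ u, ∑ v, hits G p u v * e p v = ∑ p, ∑ u, ∑ v, hits G p u v * e u v := by
    rw [Finset.sum_comm]
    refine Finset.sum_congr rfl fun p _ => Finset.sum_congr rfl fun u _ =>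
      Finset.sum_congr rfl fun v _ => ?_
    rw [hits_rotate]
  have h3 : ∑ p, ∑ u, ∑ v, hits G p u v * e p u = ∑ p, ∑ u, ∑ v, hits G p u v * e p v := by
    refine Finset.sum_congr rfl fun p _ => ?_
    rw [Finset.sum_comm]
    refine Finset.sum_congr rfl fun u _ => Finset.sum_congr rfl fun v _ => ?_
    rw [hits_swap]
  have h4 : ∑ p, ∑ u, ∑ v, hits G p u v * e u v ≤ n.factorial * (2 * cost G c) := by
    calc _ = ∑ u, ∑ p, ∑ v, hits G p u v * e u v := Finset.sum_comm
      _ = ∑ u, ∑ v, ∑ p, hits G p u v * e u v :=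
        Finset.sum_congr rfl fun u _ => Finset.sum_comm
      _ ≤ ∑ u, ∑ v, n.factorial * e u v := by
        refine Finset.sum_le_sum fun u _ => Finset.sum_le_sum fun v _ => ?_
        rw [← Finset.sum_mul]
        exact Nat.mul_le_mul_right _ (sum_hits_le u v)
      _ = _ := by
        rw [two_mul_cost, Finset.mul_sum]
        exact Finset.sum_congr rfl fun u _ => (Finset.mul_sum _ _ _).symm
  calc _ ≤ ∑ p, ∑ u, ∑ v,
        (hits G p u v * e u v + hits G p u v * e p u + hits G p u v * e p v) :=
        Finset.sum_le_sum fun p _ => Finset.sum_le_sum fun u _ => Finset.sum_le_sum fun v _ =>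
          h1 p u v
    _ = 3 * ∑ p, ∑ u, ∑ v, hits G p u v * e u v := by
        simp only [Finset.sum_add_distrib]
        rw [h3, h2]; ring
    _ ≤ _ := Nat.mul_le_mul_left _ h4

/-- The sequential Pivot algorithm is a 3-approximation in expectation. -/
theorem sum_cost_pivot_le (G : SimpleGraph (Fin n)) :
    ∑ π : Equiv.Perm (Fin n), cost G (pivotClustering G π) ≤ 3 * (n.factorial * opt G) := by
  obtain ⟨c, hc⟩ := exists_cost_eq_opt G
  have h1 := (two_mul_sum_cost_pivot_le (G := G)).trans (sum_hits_le_cost c)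
  rw [hc] at h1
  have : 3 * (n.factorial * (2 * opt G)) = 2 * (3 * (n.factorial * opt G)) := by ring
  omega

end ThreeApprox

/-! ### The rounds of the truncated algorithm -/

section Rounds

variable {n : ℕ} {G : SimpleGraph (Fin n)} {π σ : Equiv.Perm (Fin n)} {u v p q : Fin n} {t : ℕ}

theorem pivotState_succ (G : SimpleGraph (Fin n)) (π : Equiv.Perm (Fin n)) (t : ℕ) :
    pivotState G π (t + 1) = pivotRound G π (pivotState G π t) :=
  Function.iterate_succ_apply' _ _ _

/-- What the state after `t` rounds says about the sequential algorithm. -/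
structure StateInv (G : SimpleGraph (Fin n)) (π : Equiv.Perm (Fin n)) (s : PivotState n) :
    Prop where
  isPivot : ∀ v ∈ s.pivots, IsPivot G π v
  mem_or_mem : ∀ v, IsPivot G π v → v ∈ s.unsettled ∨ v ∈ s.pivots
  not_mem : ∀ v ∈ s.unsettled, v ∉ s.pivots
  not_adj : ∀ v ∈ s.unsettled, ∀ p ∈ s.pivots, ¬ G.Adj p v
  settled : ∀ v ∉ s.unsettled, v ∈ s.pivots ∨ ∃ p ∈ s.pivots, G.Adj p v

theorem StateInv.isPivot_new {s : PivotState n} (h : StateInv G π s) (hv : v ∈ newPivots G π s) :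
    IsPivot G π v := by
  rw [isPivot_iff]
  intro u hu hlt hup
  rcases h.mem_or_mem u hup with h1 | h1
  · exact absurd (hv.2 u h1 hu) (not_lt.2 hlt.le)
  · exact h.not_adj v hv.1 u h1 hu.symm

theorem stateInv (G : SimpleGraph (Fin n)) (π : Equiv.Perm (Fin n)) (t : ℕ) :
    StateInv G π (pivotState G π t) := by
  induction t with
  | zero =>
    exact ⟨fun v hv => hv.elim, fun v _ => Or.inl trivial, fun v _ h => h, fun v _ p h => h.elim,
      fun v hv => absurd trivial hv⟩
  | succ t ih =>
    rw [pivotState_succ]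
    set s := pivotState G π t
    have hp : ∀ v ∈ (pivotRound G π s).pivots, IsPivot G π v := by
      rintro v (hv | hv)
      · exact ih.isPivot v hv
      · exact ih.isPivot_new hv
    refine ⟨hp, ?_, ?_, ?_, ?_⟩
    · intro v hv
      rcases ih.mem_or_mem v hv with h | h
      · by_cases hn : v ∈ newPivots G π s
        · exact Or.inr (Or.inr hn)
        · exact Or.inl ⟨h, hn, fun p hpn => (ih.isPivot_new hpn).not_adj hv⟩
      · exact Or.inr (Or.inl h)
    · rintro v ⟨h1, h2, h3⟩ (h | h)
      · exact ih.not_mem v h1 h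
      · exact h2 h
    · rintro v ⟨h1, h2, h3⟩ p (h | h)
      · exact ih.not_adj v h1 p h
      · exact h3 p h
    · intro v hv
      by_cases h : v ∈ s.unsettled
      · by_cases hn : v ∈ newPivots G π s
        · exact Or.inl (Or.inr hn)
        · have : ¬ ∀ p ∈ newPivots G π s, ¬ G.Adj p v := fun h' => hv ⟨h, hn, h'⟩
          push Not at this
          obtain ⟨p, h1, h2⟩ := this
          exact Or.inr ⟨p, Or.inr h1, h2⟩
      · rcases ih.settled v h with h | ⟨p, h1, h2⟩
        · exact Or.inl (Or.inl h)
        · exact Or.inr ⟨p, Or.inl h1, h2⟩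

theorem head_unsettled (h : v ∈ (pivotState G π t).unsettled) :
    head G π v ∈ (pivotState G π t).unsettled := by
  rcases head_eq_or_adj (G := G) (π := π) (u := v) with h1 | h1
  · rwa [h1]
  · rcases (stateInv G π t).mem_or_mem _ isPivot_head with h2 | h2
    · exact h2
    · exact absurd h1.symm ((stateInv G π t).not_adj v h _ h2)

/-- A pivot that is still unsettled after `t + 1` rounds has a neighbour of smaller rank that is
unsettled after `t` rounds. -/
theorem exists_unsettled_adj (h : p ∈ (pivotState G π (t + 1)).unsettled) :
    ∃ x ∈ (pivotState G π t).unsettled, G.Adj p x ∧ π x < π p := by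
  rw [pivotState_succ] at h
  have h1 : ¬ ∀ u ∈ (pivotState G π t).unsettled, G.Adj p u → π p < π u := fun h' => h.2.1 ⟨h.1, h'⟩
  push Not at h1
  obtain ⟨x, hx, hadj, hle⟩ := h1
  exact ⟨x, hx, hadj, lt_of_le_of_ne hle fun e => hadj.ne (π.injective e).symm⟩

/-! The cluster heads of the truncated algorithm. -/

theorem Joins.eq_head (h : Joins G π (pivotState G π t) u p) : p = head G π u := by
  obtain ⟨hu, hp, hadj, hmin, hno⟩ := h
  have hpp := (stateInv G π t).isPivot p hp
  refine (head_unique hpp (Or.inr hadj) fun q hq hqu => ?_).symm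
  rcases hqu with rfl | hqu
  · exact absurd hadj (hq.not_adj hpp)
  · rcases (stateInv G π t).mem_or_mem q hq with h1 | h1
    · by_contra hlt
      exact hno ⟨q, h1, hqu, fun p' hp' ha => (not_le.1 hlt).trans_le (hmin p' hp' ha)⟩
    · exact hmin q h1 hqu

theorem clusterHead_of_joins (h : Joins G π (pivotState G π t) u p) :
    clusterHead G π (pivotState G π t) u = p := by
  have hex : ∃ v, Joins G π (pivotState G π t) u v := ⟨p, h⟩
  rw [clusterHead, dif_pos hex, hex.choose_spec.eq_head, h.eq_head]

theorem clusterHead_of_not_joins (h : ¬ ∃ v, Joins G π (pivotState G π t) u v) :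
    clusterHead G π (pivotState G π t) u = u := by
  rw [clusterHead, dif_neg h]

/-- The truncated algorithm refines the clustering of the sequential one. -/
theorem rPivot_le (h : rPivot t G π u v) : pivotClustering G π u v := by
  have key : ∀ {u v : Fin n}, Joins G π (pivotState G π t) u v → head G π u = head G π v :=
    fun h => by
      rw [((stateInv G π t).isPivot _ h.2.1).head_eq, h.eq_head]
  change clusterHead _ _ _ _ = clusterHead _ _ _ _ at h
  change head G π u = head G π v
  by_cases hu : ∃ x, Joins G π (pivotState G π t) u x <;>
    by_cases hv : ∃ x, Joins G π (pivotState G π t) v x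
  · obtain ⟨x, hx⟩ := hu
    obtain ⟨y, hy⟩ := hv
    rw [clusterHead_of_joins hx, clusterHead_of_joins hy] at h
    rw [key hx, key hy, h]
  · obtain ⟨x, hx⟩ := hu
    rw [clusterHead_of_joins hx, clusterHead_of_not_joins hv] at h
    rw [key hx, h]
  · obtain ⟨y, hy⟩ := hv
    rw [clusterHead_of_not_joins hu, clusterHead_of_joins hy] at h
    rw [key hy, h]
  · rw [clusterHead_of_not_joins hu, clusterHead_of_not_joins hv] at h
    rw [h]

/-- A vertex whose pivot is found within the first `t` rounds, but which does not join it, has a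
neighbour of smaller rank than this pivot that is not settled yet. -/
theorem exists_unsettled_of_clusterHead_ne (hp : head G π u ∈ (pivotState G π t).pivots)
    (h : clusterHead G π (pivotState G π t) u ≠ head G π u) :
    head G π u ≠ u ∧
      ∃ w ∈ (pivotState G π t).unsettled, G.Adj u w ∧ π w < π (head G π u) := by
  have hnj : ¬ ∃ v, Joins G π (pivotState G π t) u v := by
    rintro ⟨v, hv⟩
    exact h (by rw [clusterHead_of_joins hv, hv.eq_head])
  have hne : head G π u ≠ u := by
    rw [clusterHead_of_not_joins hnj] at h
    exact h.symm
  refine ⟨hne, ?_⟩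
  have hadj := adj_head hne
  by_contra hno
  refine hnj ⟨head G π u, fun hu => ?_, hp, hadj, fun q hq ha =>
    head_le ((stateInv G π t).isPivot q hq) (Or.inr ha), ?_⟩
  · exact hne ((stateInv G π t).isPivot u hu).head_eq
  · rintro ⟨w, hw, ha, hlt⟩
    exact hno ⟨w, hw, ha, hlt _ hp hadj⟩

end Rounds

/-! ### Encoding dependency chains -/

section Chains

variable {n : ℕ} {G : SimpleGraph (Fin n)} {π σ : Equiv.Perm (Fin n)} {u v p q a b : Fin n} {t : ℕ}

/-- A permutation together with an ordered pair of vertices. -/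
abbrev Code (n : ℕ) := Equiv.Perm (Fin n) × Fin n × Fin n

/-- The vertex that took over the rank of the second vertex of the pair. -/
noncomputable def Code.captor (G : SimpleGraph (Fin n)) (c : Code n) : Fin n := head G c.1 c.2.1

/-- The permutation after the rank of the second vertex of the pair has been given back. -/
noncomputable def Code.restore (G : SimpleGraph (Fin n)) (c : Code n) : Equiv.Perm (Fin n) :=
  c.1 * Equiv.swap c.2.2 (c.captor G)

/-- The vertex that took over the rank of the first vertex of the pair. -/
noncomputable def Code.next (G : SimpleGraph (Fin n)) (c : Code n) : Fin n :=
  head G (c.restore G) (c.captor G)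

/-- Decoding one link of a chain: both exchanges of ranks are undone. -/
noncomputable def Code.back (G : SimpleGraph (Fin n)) (c : Code n) : Code n :=
  (c.restore G * Equiv.swap c.2.1 (c.next G), c.next G, c.captor G)

/-- The code marks the upper end of a chain. -/
def Code.IsRoot (G : SimpleGraph (Fin n)) (c : Code n) : Prop :=
  c.next G = c.2.1 ∨ G.Adj c.2.1 (c.next G)

/-- The edge `a b` of the code `(σ, a, b)` is cut by Pivot on `σ`, and `b` is captured first. -/
def Code.IsCut (G : SimpleGraph (Fin n)) (c : Code n) : Prop :=
  G.Adj c.2.1 c.2.2 ∧ c.1 (head G c.1 c.2.2) < c.1 (head G c.1 c.2.1)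

/-- `(σ, a, b)` encodes a chain of dependencies under `π` whose last link is the edge `a b`: below
the rank of `b` nothing has changed, and `a` is undominated up to there, while `b`
is captured before. -/
structure Link (G : SimpleGraph (Fin n)) (π : Equiv.Perm (Fin n)) (c : Code n) : Prop where
  agree : AgreeBelow (π c.2.2) π c.1
  free : Free G π (π c.2.2) c.2.1
  adj : G.Adj c.2.1 c.2.2
  lt : π c.2.2 < π c.2.1
  not_pivot : ¬ IsPivot G π c.2.2

theorem Link.isCut {c : Code n} (h : Link G π c) : c.IsCut G := by
  obtain ⟨σ, a, b⟩ := c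
  obtain ⟨hag, hf, hadj, hlt, hb⟩ := h
  dsimp only at *
  refine ⟨hadj, ?_⟩
  have hq : π (head G π b) < π b := head_lt hb
  have hle : σ (head G σ b) < π b := by
    refine lt_of_le_of_lt (head_le ((hag.isPivot hq).1 isPivot_head) ?_) (hag _ hq ▸ hq)
    exact head_eq_or_adj
  refine lt_of_lt_of_le hle (not_lt.1 fun h => ?_)
  have hg : IsPivot G π (head G σ a) := (hag.symm.isPivot h).1 isPivot_head
  have hgl : π (head G σ a) < π b := by rwa [hag.symm _ h]
  rcases head_eq_or_adj (G := G) (π := σ) (u := a) with e | e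
  · rw [e] at hgl
    exact absurd hgl (not_lt.2 hlt.le)
  · exact hf _ hg hgl e

/-- A chain is extended by a link `a' b'`, where `a'` is the pivot of `b`, by exchanging first the
ranks of `a'` and `a`, then those of `b'` and `b`. Both exchanges can be read off from the pivots
of the resulting permutations. -/
theorem Link.extend {c : Code n} (h : Link G π c) {a' b' : Fin n} (ha' : a' = head G π c.2.2)
    (hadj' : G.Adj a' b') (hlt' : π b' < π a') (hb' : ¬ IsPivot G π b') :
    let c' : Code n := (c.1 * Equiv.swap a' c.2.1 * Equiv.swap b' c.2.2, a', b')
    c'.back G = c ∧ ¬ c'.IsRoot G ∧ Link G π c' := by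
  obtain ⟨σ, a, b⟩ := c
  obtain ⟨hag, hf, hadj, hlt, hb⟩ := h
  dsimp only at *
  have hpa' : IsPivot G π a' := ha' ▸ isPivot_head
  have hq : π a' < π b := ha' ▸ head_lt hb
  have haa' : ¬ G.Adj a' a := fun h => hf a' hpa' hq h.symm
  have hne1 : a ≠ a' := by rintro rfl; exact absurd hq (not_lt.2 hlt.le)
  have hne2 : b ≠ a' := by rintro rfl; exact lt_irrefl _ hq
  have hba' : G.Adj b a' := ha' ▸ adj_head (ha' ▸ hne2.symm)
  set ρ := σ * Equiv.swap a' a with hρ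
  have hagρ : AgreeBelow (π a') π ρ :=
    (hag.mono hq.le).mul_swap le_rfl (hq.trans hlt).le
  have hρa : ρ a = π a' := by simp [hρ, hag a' hq]
  have hρa' : π b ≤ ρ a' := by simp only [hρ, Equiv.Perm.mul_apply, Equiv.swap_apply_left]
                               exact hag.le hlt.le
  have hρb : π b ≤ ρ b := by
    rw [hρ, Equiv.Perm.mul_apply, Equiv.swap_apply_of_ne_of_ne hne2 hadj.ne.symm]
    exact hag.le le_rfl
  have hfb : Free G π (π a') b := ha' ▸ free_head
  have hnext : head G ρ b = a :=
    head_eq_of_free hagρ hρa (hf.mono hq.le) hfb hadj.symm (hq.le.trans hρb)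
  set σ' := ρ * Equiv.swap b' b with hσ'
  have hagσ : AgreeBelow (π b') π σ' :=
    (hagρ.mono hlt'.le).mul_swap le_rfl (hlt'.trans hq).le
  have hσb : σ' b = π b' := by simp [hσ', hagρ b' hlt']
  have hσa' : σ' a' = ρ a' := by
    rw [hσ', Equiv.Perm.mul_apply, Equiv.swap_apply_of_ne_of_ne hadj'.ne hne2.symm]
  have hcap : head G σ' a' = b :=
    head_eq_of_free hagσ hσb (hfb.mono hlt'.le) hpa'.free hba'.symm
      (hσa' ▸ (hlt'.trans hq).le.trans hρa')
  have hres : Code.restore G (σ', a', b') = ρ := by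
    simp only [Code.restore, Code.captor]
    rw [hcap, hσ', mul_assoc, Equiv.swap_mul_self, mul_one]
  have hnx : Code.next G (σ', a', b') = a := by
    rw [Code.next, hres]
    simp only [Code.captor]
    rw [hcap, hnext]
  refine ⟨?_, ?_, ⟨hagσ, hpa'.free, hadj', hlt', hb'⟩⟩
  · rw [Code.back, hres, hnx]
    simp only [Code.captor]
    rw [hcap, hρ, mul_assoc, Equiv.swap_mul_self, mul_one]
  · rw [Code.IsRoot, hnx]
    rintro (e | e)
    · exact hne1 e
    · exact haa' e

/-- A chain whose last pivot is unsettled for `t` rounds can be extended by `t` links. -/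
theorem Link.exists_chain {c : Code n} (h : Link G π c)
    (ht : head G π c.2.2 ∈ (pivotState G π t).unsettled) :
    ∃ T : ℕ → Code n, T 0 = c ∧ (∀ j ≤ t, (T j).IsCut G) ∧
      ∀ j < t, (T (j + 1)).back G = T j ∧ ¬ (T (j + 1)).IsRoot G := by
  induction t generalizing c with
  | zero => exact ⟨fun _ => c, rfl, fun _ _ => h.isCut, fun j hj => absurd hj (Nat.not_lt_zero j)⟩
  | succ t ih =>
    obtain ⟨x, hx, hadj, hlt⟩ := exists_unsettled_adj ht
    have hnp : ¬ IsPivot G π x := fun hx => isPivot_head.not_adj hx hadj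
    obtain ⟨h1, h2, h3⟩ := h.extend rfl hadj hlt hnp
    obtain ⟨T, hT0, hT1, hT2⟩ := ih h3 (head_unsettled hx)
    refine ⟨fun j => Nat.casesOn j c T, rfl, ?_, ?_⟩
    · rintro (_ | j) hj
      · exact h.isCut
      · exact hT1 j (by omega)
    · rintro (_ | j) hj
      · change (T 0).back G = c ∧ ¬ (T 0).IsRoot G
        rw [hT0]
        exact ⟨h1, h2⟩
      · exact hT2 j (by omega)

/-- Counting chains: if each element of a finite set `F` is the root of a chain with `r` links, and
the root determines the element, then `r * |F|` is at most the number of codes of cut edges. -/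
theorem card_mul_le_card_cut {α : Type*} (F : Finset α) (r : ℕ) (T : α → ℕ → Code n)
    (hroot : ∀ x ∈ F, (T x 0).IsRoot G) (hinj : ∀ x ∈ F, ∀ y ∈ F, T x 0 = T y 0 → x = y)
    (hcut : ∀ x ∈ F, ∀ j < r, (T x j).IsCut G)
    (hback : ∀ x ∈ F, ∀ j, j + 1 < r → (T x (j + 1)).back G = T x j ∧ ¬ (T x (j + 1)).IsRoot G)
    (K : Finset (Code n)) (hK : ∀ c : Code n, c.IsCut G → c ∈ K) : r * F.card ≤ K.card := by
  have key : ∀ x ∈ F, ∀ y ∈ F, ∀ i j, i < r → j < r → T x i = T y j → x = y ∧ i = j := by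
    intro x hx y hy i
    induction i with
    | zero =>
      rintro (_ | j) hi hj h
      · exact ⟨hinj x hx y hy h, rfl⟩
      · exact absurd (h ▸ hroot x hx) (hback y hy j hj).2
    | succ i ih =>
      rintro (_ | j) hi hj h
      · exact absurd (h ▸ hroot y hy) (hback x hx i hi).2
      · have h1 : T x i = T y j := by
          rw [← (hback x hx i hi).1, ← (hback y hy j hj).1, h]
        obtain ⟨h2, h3⟩ := ih j (by omega) (by omega) h1
        exact ⟨h2, by rw [h3]⟩
  rw [mul_comm]
  calc F.card * r = (F ×ˢ Finset.range r).card := by rw [Finset.card_product, Finset.card_range]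
    _ ≤ K.card := by
      refine Finset.card_le_card_of_injOn (fun x => T x.1 x.2) ?_ ?_
      · rintro ⟨x, j⟩ hx
        simp only [Finset.coe_product, Set.mem_prod, Finset.mem_coe, Finset.mem_range] at hx
        exact hK _ (hcut x hx.1 j hx.2)
      · rintro ⟨x, i⟩ hx ⟨y, j⟩ hy h
        simp only [Finset.coe_product, Set.mem_prod, Finset.mem_coe, Finset.mem_range] at hx hy
        obtain ⟨h1, h2⟩ := key x hx.1 y hy.1 i j hx.2 hy.2 h
        rw [h1, h2]

end Chains

/-! ### The expected cost of the truncated algorithm -/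

section Truncation

variable {n : ℕ} {G : SimpleGraph (Fin n)} {π σ : Equiv.Perm (Fin n)} {u v w x : Fin n} {r : ℕ}

/-- The edge `u v` lies inside a cluster of the sequential algorithm whose pivot, different from
`v`, is not found in `r` rounds. -/
structure LatePivot (G : SimpleGraph (Fin n)) (r : ℕ) (π : Equiv.Perm (Fin n)) (u v : Fin n) :
    Prop where
  adj : G.Adj u v
  head_eq : head G π u = head G π v
  ne : head G π v ≠ v
  unsettled : head G π v ∈ (pivotState G π r).unsettled

/-- The edge `u v` lies inside a cluster of the sequential algorithm, and `u`, which is not the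
pivot, has an unsettled neighbour of smaller rank than the pivot after `r` rounds. -/
structure LateNeighbor (G : SimpleGraph (Fin n)) (r : ℕ) (π : Equiv.Perm (Fin n)) (u v : Fin n) :
    Prop where
  adj : G.Adj u v
  head_eq : head G π u = head G π v
  ne : head G π u ≠ u
  exists_unsettled : ∃ w ∈ (pivotState G π r).unsettled, G.Adj u w ∧ π w < π (head G π u)

/-- The edge `u v` is cut by the truncated, but not by the sequential algorithm. -/
structure Extra (G : SimpleGraph (Fin n)) (r : ℕ) (π : Equiv.Perm (Fin n)) (u v : Fin n) :
    Prop where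
  adj : G.Adj u v
  head_eq : head G π u = head G π v
  not_same : ¬ rPivot r G π u v

theorem Extra.late (h : Extra G r π u v) : (LatePivot G r π u v ∨ LatePivot G r π v u) ∨
    LateNeighbor G r π u v ∨ LateNeighbor G r π v u := by
  obtain ⟨hadj, he, hns⟩ := h
  rcases (stateInv G π r).mem_or_mem _ (isPivot_head (u := v)) with hp | hp
  · left
    by_cases hv : head G π v = v
    · refine Or.inr ⟨hadj.symm, he.symm, fun hu => ?_, he ▸ hp⟩
      exact hadj.ne (by rw [← hu, he, hv])
    · exact Or.inl ⟨hadj, he, hv, hp⟩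
  · right
    by_cases hu : clusterHead G π (pivotState G π r) u = head G π u
    · by_cases hv : clusterHead G π (pivotState G π r) v = head G π v
      · exact absurd (show clusterHead _ _ _ _ = clusterHead _ _ _ _ by rw [hu, hv, he]) hns
      · obtain ⟨h1, h2⟩ := exists_unsettled_of_clusterHead_ne hp hv
        exact Or.inr ⟨hadj.symm, he.symm, h1, h2⟩
    · obtain ⟨h1, h2⟩ := exists_unsettled_of_clusterHead_ne (he ▸ hp) hu
      exact Or.inl ⟨hadj, he, h1, h2⟩

/-- The upper end of the chain of an edge `u v` whose pivot `p` is late: the ranks of `p` and `u` are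
exchanged, then those of `v` and of a neighbour `x` of `p` of smaller rank. -/
theorem LatePivot.root (h : LatePivot G r π u v) (hx : G.Adj (head G π v) x)
    (hlt : π x < π (head G π v)) :
    let c : Code n := (π * Equiv.swap (head G π v) u * Equiv.swap x v, head G π v, x)
    c.back G = (π, u, v) ∧ c.IsRoot G ∧ Link G π c := by
  obtain ⟨hadj, he, hne, -⟩ := h
  dsimp only
  have hvp : G.Adj v (head G π v) := adj_head hne
  have hpu : head G π v = u ∨ G.Adj (head G π v) u := by
    rw [← he]
    rcases head_eq_or_adj (G := G) (π := π) (u := u) with h1 | h1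
    · exact Or.inl h1
    · exact Or.inr h1.symm
  have hule : π (head G π v) ≤ π u := he ▸ head_le_self
  have hvle : π (head G π v) ≤ π v := head_le_self
  have hfu : Free G π (π (head G π v)) u := he ▸ free_head
  have hfv : Free G π (π (head G π v)) v := free_head
  have hpp : IsPivot G π (head G π v) := isPivot_head
  set p := head G π v with hp
  set ρ := π * Equiv.swap p u with hρ
  have hag : AgreeBelow (π p) π ρ := (AgreeBelow.refl _ π).mul_swap le_rfl hule
  have hρu : ρ u = π p := by simp [hρ]
  have hρp : ρ p = π u := by simp [hρ]
  have hρv : ρ v = π v := by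
    rw [hρ, Equiv.Perm.mul_apply, Equiv.swap_apply_of_ne_of_ne hne.symm hadj.ne.symm]
  have hnext : head G ρ v = u :=
    head_eq_of_free hag hρu hfu hfv hadj.symm (hρv ▸ hvle)
  set τ := ρ * Equiv.swap x v with hτ
  have hagτ : AgreeBelow (π x) π τ := (hag.mono hlt.le).mul_swap le_rfl (hlt.le.trans hvle)
  have hτv : τ v = π x := by simp [hτ, hag x hlt]
  have hτp : τ p = π u := by
    rw [hτ, Equiv.Perm.mul_apply, Equiv.swap_apply_of_ne_of_ne hx.ne hne, hρp]
  have hcap : head G τ p = v :=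
    head_eq_of_free hagτ hτv (hfv.mono hlt.le) hpp.free hvp.symm (hτp ▸ hlt.le.trans hule)
  have hres : Code.restore G (τ, p, x) = ρ := by
    simp only [Code.restore, Code.captor]
    rw [hcap, hτ, mul_assoc, Equiv.swap_mul_self, mul_one]
  have hnx : Code.next G (τ, p, x) = u := by
    rw [Code.next, hres]
    simp only [Code.captor]
    rw [hcap, hnext]
  refine ⟨?_, ?_, ⟨hagτ, hpp.free, hx, hlt, fun h => h.not_adj hpp hx.symm⟩⟩
  · rw [Code.back, hres, hnx]
    simp only [Code.captor]
    rw [hcap, hρ, mul_assoc, Equiv.swap_mul_self, mul_one]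
  · rw [Code.IsRoot, hnx]
    exact hpu.imp Eq.symm id

/-- The upper end of the chain of an edge `u v` whose end `u` has a late neighbour `w`: the ranks of
`v` and `w` are exchanged. -/
theorem LateNeighbor.root (h : LateNeighbor G r π u v) (hw : G.Adj u w)
    (hlt : π w < π (head G π u)) :
    let c : Code n := (π * Equiv.swap w v, u, w)
    (c.restore G, c.2.1, c.captor G) = (π, u, v) ∧ c.IsRoot G ∧ Link G π c := by
  obtain ⟨hadj, he, hne, -⟩ := h
  dsimp only
  have hup : G.Adj u (head G π u) := adj_head hne
  have hule : π (head G π u) ≤ π u := head_le_self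
  have hvle : π (head G π u) ≤ π v := he ▸ head_le_self
  have hfu : Free G π (π (head G π u)) u := free_head
  have hfv : Free G π (π (head G π u)) v := he ▸ free_head
  set p := head G π u with hp
  set τ := π * Equiv.swap w v with hτ
  have hagτ : AgreeBelow (π w) π τ :=
    (AgreeBelow.refl _ π).mul_swap le_rfl (hlt.le.trans hvle)
  have hτv : τ v = π w := by simp [hτ]
  have hτu : τ u = π u := by
    rw [hτ, Equiv.Perm.mul_apply, Equiv.swap_apply_of_ne_of_ne hw.ne hadj.ne]
  have hcap : head G τ u = v :=
    head_eq_of_free hagτ hτv (hfv.mono hlt.le) (hfu.mono hlt.le) hadj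
      (hτu ▸ hlt.le.trans hule)
  have hres : Code.restore G (τ, u, w) = π := by
    simp only [Code.restore, Code.captor]
    rw [hcap, hτ, mul_assoc, Equiv.swap_mul_self, mul_one]
  refine ⟨?_, ?_, ⟨hagτ, hfu.mono hlt.le, hw, hlt.trans_le hule, fun h => hfu w h hlt hw⟩⟩
  · simp only [Code.captor]
    rw [hres, hcap]
  · rw [Code.IsRoot, Code.next, hres]
    simp only [Code.captor]
    rw [hcap, ← he]
    exact Or.inr hup

open Classical in
/-- The codes of edges cut by Pivot. -/
noncomputable def cutCodes (G : SimpleGraph (Fin n)) : Finset (Code n) :=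
  Finset.univ.filter fun c => c.IsCut G

theorem mem_cutCodes {c : Code n} (h : c.IsCut G) : c ∈ cutCodes G := by
  simp [cutCodes, h]

theorem card_cutCodes_le (G : SimpleGraph (Fin n)) :
    (cutCodes G).card ≤ ∑ π : Equiv.Perm (Fin n), cost G (pivotClustering G π) := by
  classical
  have h1 : (cutCodes G).card =
      ∑ π : Equiv.Perm (Fin n), ∑ a, ∑ b, if Code.IsCut G (π, a, b) then 1 else 0 := by
    rw [cutCodes, Finset.card_filter, Fintype.sum_prod_type]
    exact Finset.sum_congr rfl fun π _ => Fintype.sum_prod_type _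
  rw [h1]
  refine Finset.sum_le_sum fun π _ => ?_
  -- The codes orient each cut edge in one way only, whereas the errors are counted in both.
  have h2 : 2 * (∑ a, ∑ b, if Code.IsCut G (π, a, b) then 1 else 0) ≤
      2 * cost G (pivotClustering G π) := by
    rw [two_mul_cost, two_mul]
    nth_rewrite 2 [Finset.sum_comm]
    rw [← Finset.sum_add_distrib]
    refine Finset.sum_le_sum fun a _ => ?_
    rw [← Finset.sum_add_distrib]
    refine Finset.sum_le_sum fun b _ => ?_
    have e : ∀ {a b : Fin n}, G.Adj a b → head G π a ≠ head G π b →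
        Errs G (pivotClustering G π) a b := fun ha hne => ⟨ha.ne, fun _ => hne, fun _ => ha⟩
    by_cases hab : Code.IsCut G (π, a, b)
    · have hba : ¬ Code.IsCut G (π, b, a) := fun h => lt_asymm hab.2 h.2
      have : Errs G (pivotClustering G π) a b := e hab.1 fun h => absurd hab.2 (by simp [h])
      simp [hab, hba, this]
    · by_cases hba : Code.IsCut G (π, b, a)
      · have : Errs G (pivotClustering G π) a b :=
          e hba.1.symm fun h => absurd hba.2 (by simp [h])
        simp [hab, hba, this]
      · simp [hab, hba]
  omega

open Classical in
theorem mul_card_latePivot_le (hr : 1 ≤ r) :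
    r * ∑ π : Equiv.Perm (Fin n), ∑ u, ∑ v, (if LatePivot G r π u v then 1 else 0) ≤
      (cutCodes G).card := by
  have key : ∀ x : Code n, LatePivot G r x.1 x.2.1 x.2.2 → ∃ T : ℕ → Code n,
      ((T 0).back G = x ∧ (T 0).IsRoot G) ∧ (∀ j < r, (T j).IsCut G) ∧
        ∀ j, j + 1 < r → (T (j + 1)).back G = T j ∧ ¬ (T (j + 1)).IsRoot G := by
    rintro ⟨π, u, v⟩ h
    obtain ⟨t, rfl⟩ : ∃ t, r = t + 1 := ⟨r - 1, by omega⟩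
    obtain ⟨x, hx, hadj, hlt⟩ := exists_unsettled_adj h.unsettled
    obtain ⟨h1, h2, h3⟩ := h.root hadj hlt
    obtain ⟨T, hT0, hT1, hT2⟩ := h3.exists_chain (head_unsettled hx)
    exact ⟨T, by rw [hT0]; exact ⟨h1, h2⟩, fun j hj => hT1 j (by omega),
      fun j hj => hT2 j (by omega)⟩
  choose! T hT using key
  have := card_mul_le_card_cut (G := G)
    (Finset.univ.filter fun x : Code n => LatePivot G r x.1 x.2.1 x.2.2) r T
    (fun x hx => (hT x (by simpa using hx)).1.2)
    (fun x hx y hy e => by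
      rw [← (hT x (by simpa using hx)).1.1, ← (hT y (by simpa using hy)).1.1, e])
    (fun x hx => (hT x (by simpa using hx)).2.1)
    (fun x hx => (hT x (by simpa using hx)).2.2) (cutCodes G) (fun _ => mem_cutCodes)
  rw [Finset.card_filter, Fintype.sum_prod_type] at this
  simpa only [Fintype.sum_prod_type] using this

open Classical in
theorem mul_card_lateNeighbor_le :
    r * ∑ π : Equiv.Perm (Fin n), ∑ u, ∑ v, (if LateNeighbor G r π u v then 1 else 0) ≤
      (cutCodes G).card := by
  have key : ∀ x : Code n, LateNeighbor G r x.1 x.2.1 x.2.2 → ∃ T : ℕ → Code n,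
      (((T 0).restore G, (T 0).2.1, (T 0).captor G) = x ∧ (T 0).IsRoot G) ∧
      (∀ j < r, (T j).IsCut G) ∧
        ∀ j, j + 1 < r → (T (j + 1)).back G = T j ∧ ¬ (T (j + 1)).IsRoot G := by
    rintro ⟨π, u, v⟩ h
    obtain ⟨w, hw, hadj, hlt⟩ := h.exists_unsettled
    obtain ⟨h1, h2, h3⟩ := h.root hadj hlt
    obtain ⟨T, hT0, hT1, hT2⟩ := h3.exists_chain (head_unsettled hw)
    exact ⟨T, by rw [hT0]; exact ⟨h1, h2⟩, fun j hj => hT1 j hj.le, fun j hj => hT2 j (by omega)⟩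
  choose! T hT using key
  have := card_mul_le_card_cut (G := G)
    (Finset.univ.filter fun x : Code n => LateNeighbor G r x.1 x.2.1 x.2.2) r T
    (fun x hx => (hT x (by simpa using hx)).1.2)
    (fun x hx y hy e => by
      rw [← (hT x (by simpa using hx)).1.1, ← (hT y (by simpa using hy)).1.1, e])
    (fun x hx => (hT x (by simpa using hx)).2.1)
    (fun x hx => (hT x (by simpa using hx)).2.2) (cutCodes G) (fun _ => mem_cutCodes)
  rw [Finset.card_filter, Fintype.sum_prod_type] at this
  simpa only [Fintype.sum_prod_type] using this

open Classical in
theorem two_mul_cost_rPivot_le (G : SimpleGraph (Fin n)) (r : ℕ) (π : Equiv.Perm (Fin n)) :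
    2 * cost G (rPivot r G π) ≤ 2 * cost G (pivotClustering G π) +
      (2 * (∑ u, ∑ v, if LatePivot G r π u v then 1 else 0) +
        2 * ∑ u, ∑ v, if LateNeighbor G r π u v then 1 else 0) := by
  rw [two_mul_cost, two_mul_cost, two_mul (∑ u, ∑ v, if LatePivot G r π u v then 1 else 0),
    two_mul (∑ u, ∑ v, if LateNeighbor G r π u v then 1 else 0)]
  nth_rewrite 4 [Finset.sum_comm]
  nth_rewrite 6 [Finset.sum_comm]
  simp only [← Finset.sum_add_distrib]
  refine Finset.sum_le_sum fun u _ => Finset.sum_le_sum fun v _ => ?_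
  by_cases h : Errs G (rPivot r G π) u v
  · rw [if_pos h]
    by_cases h' : Errs G (pivotClustering G π) u v
    · rw [if_pos h']; omega
    · have hex : Extra G r π u v := by
        obtain ⟨hne, h⟩ := h
        have hle : rPivot r G π u v → pivotClustering G π u v := rPivot_le
        have h2 : ¬ (G.Adj u v ↔ ¬ pivotClustering G π u v) := fun h2 => h' ⟨hne, h2⟩
        have h3 : G.Adj u v ∧ pivotClustering G π u v ∧ ¬ rPivot r G π u v := by tauto
        exact ⟨h3.1, h3.2.1, h3.2.2⟩
      rcases hex.late with (h1 | h1) | h1 | h1 <;> rw [if_pos h1] <;> omega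
  · rw [if_neg h]; exact Nat.zero_le _

/-- The expected cost of the truncated algorithm exceeds that of the sequential one by at most the
fraction `2 / r`. -/
theorem mul_sum_cost_rPivot_le (G : SimpleGraph (Fin n)) (hr : 1 ≤ r) :
    r * ∑ π : Equiv.Perm (Fin n), cost G (rPivot r G π) ≤
      (r + 2) * ∑ π : Equiv.Perm (Fin n), cost G (pivotClustering G π) := by
  classical
  have h1 := Finset.sum_le_sum fun (π : Equiv.Perm (Fin n)) (_ : π ∈ Finset.univ) =>
    two_mul_cost_rPivot_le G r π
  rw [Finset.sum_add_distrib, Finset.sum_add_distrib, ← Finset.mul_sum, ← Finset.mul_sum,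
    ← Finset.mul_sum, ← Finset.mul_sum] at h1
  have h2 := mul_card_latePivot_le (G := G) hr
  have h3 := mul_card_lateNeighbor_le (G := G) (r := r)
  have h4 := card_cutCodes_le G
  have h5 := Nat.mul_le_mul_left r h1
  nlinarith

end Truncation

/-! ### Partial correctness of programs -/

section Logic

variable {α β : Type*} {S w n u v : ℕ}

/-- The property `Q` holds almost surely. -/
def Surely (p : PMF α) (Q : α → Prop) : Prop := ∀ a ∈ p.support, Q a

theorem Surely.pure {Q : α → Prop} {a : α} (h : Q a) : Surely (PMF.pure a) Q := by
  intro b hb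
  rw [PMF.support_pure, Set.mem_singleton_iff] at hb
  exact hb ▸ h

theorem Surely.bind {p : PMF α} {f : α → PMF β} {P : α → Prop} {Q : β → Prop} (hp : Surely p P)
    (hf : ∀ a, P a → Surely (f a) Q) : Surely (p.bind f) Q := by
  intro b hb
  rw [PMF.mem_support_bind_iff] at hb
  obtain ⟨a, ha, hb⟩ := hb
  exact hf a (hp a ha) b hb

theorem Surely.mono {p : PMF α} {P Q : α → Prop} (hp : Surely p P) (h : ∀ a, P a → Q a) :
    Surely p Q := fun a ha => h a (hp a ha)

theorem Surely.map_eq_pure {p : PMF α} {f : α → β} {b : β} (hp : Surely p fun a => f a = b) :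
    p.map f = PMF.pure b := by
  have h : p.map f = p.map (Function.const α b) := by
    ext c
    rw [PMF.map_apply, PMF.map_apply]
    refine tsum_congr fun a => ?_
    by_cases ha : a ∈ p.support
    · rw [hp a ha]; rfl
    · rw [(PMF.apply_eq_zero_iff p a).2 ha, ite_self, ite_self]
  rw [h, PMF.map_const]

/-- The invariant rule for iterated random steps. -/
theorem Surely.foldl {γ : Type*} {f : γ → α → PMF α} (I : List γ → α → Prop) (l : List γ)
    (hI : ∀ l₁ c l₂, l = l₁ ++ c :: l₂ → ∀ a, I l₁ a → Surely (f c a) (I (l₁ ++ [c])))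
    {p : PMF α} (hp : Surely p (I [])) :
    Surely (l.foldl (fun p c => p.bind (f c)) p) (I l) := by
  induction l using List.reverseRecOn with
  | nil => exact hp
  | append_singleton l c ih =>
    rw [List.foldl_append]
    refine Surely.bind (ih fun l₁ d l₂ h => hI l₁ d (l₂ ++ [c]) (by simp [h])) ?_
    exact hI l c [] rfl

theorem Surely.store {m : Mem S w} {a x : Expr} {Q : Mem S w → Prop}
    (h : Q (m.set (a.eval n u v m) (x.eval n u v m))) : Surely ((Cmd.store a x).run n u v m) Q :=
  Surely.pure h

theorem Surely.skip {m : Mem S w} {Q : Mem S w → Prop} (h : Q m) :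
    Surely (Cmd.skip.run n u v m) Q := Surely.pure h

theorem Surely.seq {m : Mem S w} {c d : Cmd} {P Q : Mem S w → Prop}
    (hc : Surely (c.run n u v m) P) (hd : ∀ m', P m' → Surely (d.run n u v m') Q) :
    Surely ((Cmd.seq c d).run n u v m) Q := Surely.bind hc hd

theorem Surely.ite {m : Mem S w} {x : Expr} {c d : Cmd} {Q : Mem S w → Prop}
    (hc : x.eval n u v m ≠ 0 → Surely (c.run n u v m) Q)
    (hd : x.eval n u v m = 0 → Surely (d.run n u v m) Q) :
    Surely ((Cmd.ite x c d).run n u v m) Q := by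
  rw [Cmd.run]
  split_ifs with h
  · exact hc h
  · exact hd (not_not.1 h)

theorem Surely.loop {m : Mem S w} {a k : Expr} {c : Cmd} (I : ℕ → Mem S w → Prop) {N A : ℕ}
    (hk : k.eval n u v m = N) (ha : a.eval n u v m = A) (h0 : I 0 m)
    (hI : ∀ i < N, ∀ m', I i m' → Surely (c.run n u v (m'.set A i)) (I (i + 1))) :
    Surely ((Cmd.loop a k c).run n u v m) (I N) := by
  rw [Cmd.run, hk, ha]
  have := Surely.foldl (f := fun i m' => c.run n u v (Mem.set m' A i))
    (fun l => I l.length) (List.range N) ?_ (p := PMF.pure m) (Surely.pure h0)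
  · simpa using this
  · intro l₁ i l₂ h m' hm'
    have hi : i = l₁.length := by
      have h1 := congrArg (fun l => l[l₁.length]?) h
      have h2 : l₁.length < N := by
        have := congrArg List.length h
        simp at this
        omega
      simp [h2] at h1
      exact h1.symm
    subst hi
    have h2 : l₁.length < N := by
      have := congrArg List.length h
      simp at this
      omega
    simpa using hI _ h2 m' hm'

theorem Mem.get_set_self {m : Mem S w} {a x : ℕ} (ha : a < S) (hx : x < 2 ^ w) :
    (m.set a x).get a = x := by
  simp [Mem.get, Mem.set, ha, Nat.mod_eq_of_lt hx]

theorem Mem.get_set_of_ne {m : Mem S w} {a b x : ℕ} (h : b ≠ a) : (m.set a x).get b = m.get b := by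
  simp [Mem.get, Mem.set, h]

end Logic

/-! ### The streaming algorithm -/

section Program

open CorrClust.Expr CorrClust.Cmd

/-- The address of the rank of the vertex `x`; the first `n` cells are kept for the output. -/
def rankAt (x : Expr) : Expr := add order x

/-- The address of the status of the vertex `x`: `0` for unsettled vertices, `2` for pivots, `1` for
all other vertices. -/
def statusAt (x : Expr) : Expr := add (add order order) x

/-- The address of the auxiliary cell of the vertex `x`. In the first pass of a round it is a flag
for vertices with an unsettled neighbour of smaller rank; in the final pass it is `y + 1` where `y` is
the neighbour of smallest rank seen so far among pivots and unsettled vertices, and `0` if there is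
none. -/
def auxAt (x : Expr) : Expr := add (add order (add order order)) x

/-- The address of the loop counter. -/
def counterAt : Expr := add (add order order) (add order order)

/-- The address of the random index. -/
def drawAt : Expr := add counterAt (lit 1)

/-- The address of the buffer used for exchanging two ranks. -/
def bufferAt : Expr := add counterAt (lit 2)

/-- A random transposition of the rank table: the entry of the loop counter is exchanged with one of
the entries that do not come after it. -/
def shuffleStep : Cmd :=
  seq (draw drawAt (read counterAt))
    (seq (store bufferAt (read (rankAt (read counterAt))))
      (seq (store (rankAt (read counterAt)) (read (rankAt (read drawAt))))
        (store (rankAt (read drawAt)) (read bufferAt))))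

/-- The Fisher-Yates shuffle. -/
def initCmd : Cmd :=
  seq (loop counterAt order (store (rankAt (read counterAt)) (read counterAt)))
    (loop counterAt order shuffleStep)

/-- The first pass of a round finds the new pivots. -/
def findPass : Pass where
  onEdge := ite (read (statusAt src)) skip (ite (read (statusAt dst)) skip
    (ite (lt (read (rankAt src)) (read (rankAt dst))) (store (auxAt dst) (lit 1))
      (store (auxAt src) (lit 1))))
  atEnd := loop counterAt order
    (seq (ite (read (statusAt (read counterAt))) skip
        (ite (read (auxAt (read counterAt))) skip (store (statusAt (read counterAt)) (lit 2))))
      (store (auxAt (read counterAt)) (lit 0)))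

/-- Settle the unsettled vertex `y` if its neighbour `x` is a pivot. -/
def settle (x y : Expr) : Cmd :=
  ite (eq (read (statusAt x)) (lit 2))
    (ite (read (statusAt y)) skip (store (statusAt y) (lit 1))) skip

/-- The second pass of a round settles the neighbours of the pivots. -/
def settlePass : Pass where
  onEdge := seq (settle src dst) (settle dst src)
  atEnd := skip

/-- Record the neighbour `y` of `x` if it is a pivot or unsettled and its rank is smaller than that
of the neighbour recorded so far. -/
def record (x y : Expr) : Cmd :=
  ite (eq (read (statusAt y)) (lit 1)) skip
    (ite (read (auxAt x))
      (ite (lt (read (rankAt y)) (read (rankAt (sub (read (auxAt x)) (lit 1)))))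
        (store (auxAt x) (add y (lit 1))) skip)
      (store (auxAt x) (add y (lit 1))))

/-- The label of a vertex: the recorded neighbour if this is a pivot and the vertex itself is not,
and the vertex itself otherwise. -/
def labelStep : Cmd :=
  ite (eq (read (statusAt (read counterAt))) (lit 2)) (store (read counterAt) (read counterAt))
    (ite (read (auxAt (read counterAt)))
      (ite (eq (read (statusAt (sub (read (auxAt (read counterAt))) (lit 1)))) (lit 2))
        (store (read counterAt) (sub (read (auxAt (read counterAt))) (lit 1)))
        (store (read counterAt) (read counterAt)))
      (store (read counterAt) (read counterAt)))

/-- The final pass forms the clusters. -/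
def clusterPass : Pass where
  onEdge := seq (record src dst) (record dst src)
  atEnd := loop counterAt order labelStep

/-- The streaming implementation of the truncated Pivot algorithm with `r` rounds. -/
def pivotAlg (r : ℕ) : StreamAlg where
  perVertex := 4
  extra := 3
  width := 8
  init := initCmd
  passes := (List.range (2 * r)).map (fun k => if k % 2 = 0 then findPass else settlePass) ++
    [clusterPass]

end Program

/-! ### The memory layout -/

section Layout

variable {S w n : ℕ} {m : Mem S w} {R T A : Fin n → ℕ}

/-- The memory holds the ranks `R`, the statuses `T` and the auxiliary values `A`. -/
structure Holds (m : Mem S w) (R T A : Fin n → ℕ) : Prop where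
  rank : ∀ v : Fin n, m.get (n + v) = R v
  status : ∀ v : Fin n, m.get (n + n + v) = T v
  aux : ∀ v : Fin n, m.get (n + (n + n) + v) = A v

/-- There are enough cells, and the words are long enough for all values that occur. -/
structure Fits (S w n : ℕ) : Prop where
  cells : 4 * n + 3 ≤ S
  width : 4 * n + 4 ≤ 2 ^ w

theorem Holds.set_extra (h : Holds m R T A) {a x : ℕ} (ha : 4 * n ≤ a) :
    Holds (m.set a x) R T A := by
  refine ⟨fun v => ?_, fun v => ?_, fun v => ?_⟩ <;> rw [Mem.get_set_of_ne (by omega)]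
  exacts [h.rank v, h.status v, h.aux v]

theorem Holds.set_label (h : Holds m R T A) {a x : ℕ} (ha : a < n) :
    Holds (m.set a x) R T A := by
  refine ⟨fun v => ?_, fun v => ?_, fun v => ?_⟩ <;> rw [Mem.get_set_of_ne (by omega)]
  exacts [h.rank v, h.status v, h.aux v]

theorem get_set_update {f : Fin n → ℕ} (hf : Fits S w n) {b x : ℕ} (hb : b ≤ n + (n + n))
    (h : ∀ v : Fin n, m.get (b + v) = f v) (k : Fin n) (hx : x < 2 ^ w) (v : Fin n) :
    (m.set (b + k) x).get (b + v) = Function.update f k x v := by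
  have := hf.cells
  by_cases hv : v = k
  · subst hv
    rw [Mem.get_set_self (by omega) hx, Function.update_self]
  · rw [Mem.get_set_of_ne (fun e => hv (Fin.ext (by omega))), h, Function.update_of_ne hv]

theorem Holds.set_rank (hf : Fits S w n) (h : Holds m R T A) (k : Fin n) {x : ℕ}
    (hx : x < 2 ^ w) : Holds (m.set (n + k) x) (Function.update R k x) T A := by
  refine ⟨get_set_update hf (by omega) h.rank k hx, fun v => ?_, fun v => ?_⟩ <;>
    rw [Mem.get_set_of_ne (by omega)]
  exacts [h.status v, h.aux v]

theorem Holds.set_status (hf : Fits S w n) (h : Holds m R T A) (k : Fin n) {x : ℕ}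
    (hx : x < 2 ^ w) : Holds (m.set (n + n + k) x) R (Function.update T k x) A := by
  refine ⟨fun v => ?_, get_set_update hf (by omega) h.status k hx, fun v => ?_⟩ <;>
    rw [Mem.get_set_of_ne (by omega)]
  exacts [h.rank v, h.aux v]

theorem Holds.set_aux (hf : Fits S w n) (h : Holds m R T A) (k : Fin n) {x : ℕ}
    (hx : x < 2 ^ w) : Holds (m.set (n + (n + n) + k) x) R T (Function.update A k x) := by
  refine ⟨fun v => ?_, fun v => ?_, get_set_update hf (by omega) h.aux k hx⟩ <;>
    rw [Mem.get_set_of_ne (by omega)]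
  exacts [h.rank v, h.status v]

/-! Evaluation of the expressions that occur in the programs. -/

variable {u v : ℕ} {x : Expr} {k : Fin n}

theorem eval_rankAt (hf : Fits S w n) (hx : x.eval n u v m = k) :
    (rankAt x).eval n u v m = n + k := by
  have := hf.width
  simp only [rankAt, Expr.eval, hx]
  rw [Nat.mod_eq_of_lt (a := n) (by omega), Nat.mod_eq_of_lt (by omega)]

theorem eval_statusAt (hf : Fits S w n) (hx : x.eval n u v m = k) :
    (statusAt x).eval n u v m = n + n + k := by
  have := hf.width
  simp only [statusAt, Expr.eval, hx]
  rw [Nat.mod_eq_of_lt (a := n) (by omega), Nat.mod_eq_of_lt (a := n + n) (by omega),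
    Nat.mod_eq_of_lt (by omega)]

theorem eval_auxAt (hf : Fits S w n) (hx : x.eval n u v m = k) :
    (auxAt x).eval n u v m = n + (n + n) + k := by
  have := hf.width
  simp only [auxAt, Expr.eval, hx]
  rw [Nat.mod_eq_of_lt (a := n) (by omega), Nat.mod_eq_of_lt (a := n + n) (by omega),
    Nat.mod_eq_of_lt (a := n + (n + n)) (by omega), Nat.mod_eq_of_lt (by omega)]

theorem eval_counterAt (hf : Fits S w n) : counterAt.eval n u v m = 4 * n := by
  have := hf.width
  simp only [counterAt, Expr.eval]
  rw [Nat.mod_eq_of_lt (a := n) (by omega), Nat.mod_eq_of_lt (a := n + n) (by omega),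
    Nat.mod_eq_of_lt (by omega)]
  omega

theorem eval_lit (hf : Fits S w n) {c : ℕ} (hc : c ≤ 2) : (Expr.lit c).eval n u v m = c := by
  have := hf.width
  exact Nat.mod_eq_of_lt (by omega)

theorem eval_drawAt (hf : Fits S w n) : drawAt.eval n u v m = 4 * n + 1 := by
  have := hf.width
  rw [drawAt, Expr.eval, eval_counterAt hf, eval_lit hf (by omega), Nat.mod_eq_of_lt (by omega)]

theorem eval_bufferAt (hf : Fits S w n) : bufferAt.eval n u v m = 4 * n + 2 := by
  have := hf.width
  rw [bufferAt, Expr.eval, eval_counterAt hf, eval_lit hf (by omega), Nat.mod_eq_of_lt (by omega)]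

theorem eval_order (hf : Fits S w n) : Expr.order.eval n u v m = n := by
  have := hf.width
  exact Nat.mod_eq_of_lt (by omega)

theorem eval_src (hf : Fits S w n) (a : Fin n) : Expr.src.eval n a v m = a := by
  have := hf.width
  exact Nat.mod_eq_of_lt (by omega)

theorem eval_dst (hf : Fits S w n) (b : Fin n) : Expr.dst.eval n u b m = b := by
  have := hf.width
  exact Nat.mod_eq_of_lt (by omega)

theorem Holds.eval_rank (h : Holds m R T A) (hf : Fits S w n) (hx : x.eval n u v m = k) :
    (Expr.read (rankAt x)).eval n u v m = R k := by
  rw [Expr.eval, eval_rankAt hf hx, h.rank]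

theorem Holds.eval_status (h : Holds m R T A) (hf : Fits S w n) (hx : x.eval n u v m = k) :
    (Expr.read (statusAt x)).eval n u v m = T k := by
  rw [Expr.eval, eval_statusAt hf hx, h.status]

theorem Holds.eval_aux (h : Holds m R T A) (hf : Fits S w n) (hx : x.eval n u v m = k) :
    (Expr.read (auxAt x)).eval n u v m = A k := by
  rw [Expr.eval, eval_auxAt hf hx, h.aux]

theorem eval_counter (hf : Fits S w n) (i : Fin n) :
    (Expr.read counterAt).eval n u v (m.set (4 * n) i) = i := by
  have h1 := hf.width
  have h2 := hf.cells
  rw [Expr.eval, eval_counterAt hf, Mem.get_set_self (by omega) (by omega)]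

theorem eval_eq_ne_zero (hf : Fits S w n) {x y : Expr} :
    (Expr.eq x y).eval n u v m ≠ 0 ↔ x.eval n u v m = y.eval n u v m := by
  have := hf.width
  rw [Expr.eval]
  split_ifs with h
  · rw [Nat.mod_eq_of_lt (by omega)]; simp [h]
  · simp [h]

theorem eval_lt_ne_zero (hf : Fits S w n) {x y : Expr} :
    (Expr.lt x y).eval n u v m ≠ 0 ↔ x.eval n u v m < y.eval n u v m := by
  have := hf.width
  rw [Expr.eval]
  split_ifs with h
  · rw [Nat.mod_eq_of_lt (by omega)]; simp [h]
  · simp [h]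

end Layout

/-! ### Correctness of the passes -/

section Passes

variable {S w n : ℕ} {m : Mem S w} {R T A : Fin n → ℕ}

/-- The edge `x y` occurs in `l`, in one of the two orientations. -/
def Seen (l : List (Fin n × Fin n)) (x y : Fin n) : Prop := (x, y) ∈ l ∨ (y, x) ∈ l

theorem seen_append {l : List (Fin n × Fin n)} {a b x y : Fin n} :
    Seen (l ++ [(a, b)]) x y ↔ (Seen l x y ∨ (x = a ∧ y = b)) ∨ (x = b ∧ y = a) := by
  simp only [Seen, List.mem_append, List.mem_singleton, Prod.mk.injEq]
  tauto

theorem seen_append_eq (l : List (Fin n × Fin n)) (a b : Fin n) : Seen (l ++ [(a, b)]) =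
    fun x y => (Seen l x y ∨ (x = a ∧ y = b)) ∨ (x = b ∧ y = a) :=
  funext fun _ => funext fun _ => propext seen_append

/-- One pass, by an invariant over the part of the stream that has been read. -/
theorem surely_runPass (B : StreamAlg) {l : List (Fin n × Fin n)} {P : Pass} {m : B.Memory n}
    (I : List (Fin n × Fin n) → B.Memory n → Prop) {Q : B.Memory n → Prop} (h0 : I [] m)
    (hI : ∀ l₁, ∀ e ∈ l, ∀ m', I l₁ m' → Surely (P.onEdge.run n e.1 e.2 m') (I (l₁ ++ [e])))
    (hQ : ∀ m', I l m' → Surely (P.atEnd.run n 0 0 m') Q) : Surely (B.runPass n l P m) Q := by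
  refine Surely.bind (Surely.foldl (f := fun (e : Fin n × Fin n) m' => P.onEdge.run n e.1 e.2 m') I
    l ?_ (Surely.pure h0)) hQ
  rintro l₁ e l₂ rfl m' hm'
  exact hI l₁ e (by simp) m' hm'

/-! The pass that finds the new pivots. -/

/-- The flags after the part `l` of the stream. -/
def Flagged (R T : Fin n → ℕ) (l : List (Fin n × Fin n)) (A : Fin n → ℕ) : Prop :=
  ∀ x, A x ≠ 0 ↔ ∃ y, Seen l x y ∧ T x = 0 ∧ T y = 0 ∧ R y < R x

theorem surely_findPass_onEdge (hf : Fits S w n) (hR : R.Injective) {l : List (Fin n × Fin n)}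
    {a b : Fin n} (hab : a ≠ b) (h : ∃ A, Holds m R T A ∧ Flagged R T l A) :
    Surely (findPass.onEdge.run n a b m)
      fun m' => ∃ A, Holds m' R T A ∧ Flagged R T (l ++ [(a, b)]) A := by
  obtain ⟨A, h, hA⟩ := h
  have w1 : 1 < 2 ^ w := by have := hf.width; omega
  have hne : R a ≠ R b := fun e => hab (hR e)
  refine Surely.ite (fun h1 => Surely.skip ⟨A, h, fun x => ?_⟩) fun h1 =>
    Surely.ite (fun h2 => Surely.skip ⟨A, h, fun x => ?_⟩) fun h2 =>
      Surely.ite (fun h3 => Surely.store ?_) fun h3 => Surely.store ?_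
  all_goals rw [h.eval_status hf (eval_src hf a)] at h1
  · rw [hA]
    refine exists_congr fun y => ?_
    rw [seen_append]
    constructor
    · tauto
    · rintro ⟨(h2 | ⟨rfl, rfl⟩) | ⟨rfl, rfl⟩, h3, h4, h5⟩
      exacts [⟨h2, h3, h4, h5⟩, absurd h3 h1, absurd h4 h1]
  all_goals rw [h.eval_status hf (eval_dst hf b)] at h2
  · rw [hA]
    refine exists_congr fun y => ?_
    rw [seen_append]
    constructor
    · tauto
    · rintro ⟨(h2 | ⟨rfl, rfl⟩) | ⟨rfl, rfl⟩, h3, h4, h5⟩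
      exacts [⟨h2, h3, h4, h5⟩, absurd h4 h2, absurd h3 h2]
  · rw [eval_lt_ne_zero hf, h.eval_rank hf (eval_src hf a), h.eval_rank hf (eval_dst hf b)] at h3
    rw [eval_auxAt hf (eval_dst hf b), eval_lit hf (by omega)]
    refine ⟨_, h.set_aux hf b w1, fun x => ?_⟩
    by_cases hx : x = b
    · subst hx
      simp only [Function.update_self, ne_eq, one_ne_zero, not_false_eq_true, true_iff]
      exact ⟨a, seen_append.2 (Or.inr ⟨rfl, rfl⟩), h2, h1, h3⟩
    · rw [Function.update_of_ne hx, hA]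
      refine exists_congr fun y => ?_
      rw [seen_append]
      constructor
      · tauto
      · rintro ⟨(h4 | ⟨rfl, rfl⟩) | ⟨rfl, rfl⟩, h5, h6, h7⟩
        exacts [⟨h4, h5, h6, h7⟩, absurd h3 (not_lt.2 h7.le), absurd rfl hx]
  · have h3 : ¬ R a < R b := by
      intro e
      refine absurd h3 ((eval_lt_ne_zero hf).2 ?_)
      rwa [h.eval_rank hf (eval_src hf a), h.eval_rank hf (eval_dst hf b)]
    rw [eval_auxAt hf (eval_src hf a), eval_lit hf (by omega)]
    refine ⟨_, h.set_aux hf a w1, fun x => ?_⟩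
    by_cases hx : x = a
    · subst hx
      simp only [Function.update_self, ne_eq, one_ne_zero, not_false_eq_true, true_iff]
      exact ⟨b, seen_append.2 (Or.inl (Or.inr ⟨rfl, rfl⟩)), h1, h2, by omega⟩
    · rw [Function.update_of_ne hx, hA]
      refine exists_congr fun y => ?_
      rw [seen_append]
      constructor
      · tauto
      · rintro ⟨(h4 | ⟨rfl, rfl⟩) | ⟨rfl, rfl⟩, h5, h6, h7⟩
        exacts [⟨h4, h5, h6, h7⟩, absurd rfl hx, absurd h7 h3]

theorem surely_findPass_atEnd (hf : Fits S w n) (h : Holds m R T A) :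
    Surely (findPass.atEnd.run n 0 0 m) fun m' =>
      Holds m' R (fun x => if T x = 0 ∧ A x = 0 then 2 else T x) fun _ => 0 := by
  have w2 : 2 < 2 ^ w := by have := hf.width; omega
  have := Surely.loop (n := n) (u := 0) (v := 0) (m := m) (c := Cmd.seq
      (.ite (.read (statusAt (.read counterAt))) .skip (.ite (.read (auxAt (.read counterAt))) .skip
        (.store (statusAt (.read counterAt)) (.lit 2))))
      (.store (auxAt (.read counterAt)) (.lit 0)))
    (fun i m' => Holds m' R (fun x => if (x : ℕ) < i ∧ T x = 0 ∧ A x = 0 then 2 else T x)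
      fun x => if (x : ℕ) < i then 0 else A x) (eval_order hf) (eval_counterAt hf) (by simpa using h)
    ?_
  · exact this.mono fun m' h' => by simpa using h'
  intro i hi m' hm'
  lift i to Fin n using hi
  have hm := hm'.set_extra (x := i) (le_refl (4 * n))
  have hi := eval_counter (u := 0) (v := 0) (m := m') hf i
  have hs := (hm.eval_status hf hi)
  have ha := (hm.eval_aux hf hi)
  simp only [lt_self_iff_false, false_and, if_false] at hs ha
  have hc : ((m'.set (4 * n) i).set (n + n + i) 2).get (4 * n) = i := by
    have h1 := hf.width
    have h2 := hf.cells
    rw [Mem.get_set_of_ne (by omega), Mem.get_set_self (by omega) (by omega)]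
  refine Surely.seq (P := fun m'' => Holds m'' R
      (fun x => if (x : ℕ) < i + 1 ∧ T x = 0 ∧ A x = 0 then 2 else T x)
      (fun x => if (x : ℕ) < i then 0 else A x) ∧ m''.get (4 * n) = i) ?_ ?_
  · have hc' : (m'.set (4 * n) i).get (4 * n) = i := by
      have h1 := hf.width
      have h2 := hf.cells
      rw [Mem.get_set_self (by omega) (by omega)]
    have hold : (T i ≠ 0 ∨ A i ≠ 0) → Holds (m'.set (4 * n) i) R
        (fun x => if (x : ℕ) < i + 1 ∧ T x = 0 ∧ A x = 0 then 2 else T x)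
        (fun x => if (x : ℕ) < i then 0 else A x) := by
      intro h
      convert hm using 2 with x
      by_cases hx : x = i
      · subst hx
        rw [if_neg (by tauto), if_neg (by tauto)]
      · have : (x : ℕ) ≠ i := fun e => hx (Fin.ext e)
        have e : (x : ℕ) < i + 1 ↔ (x : ℕ) < i := by omega
        simp only [e]
    refine Surely.ite (fun h1 => Surely.skip ⟨hold (Or.inl (hs ▸ h1)), hc'⟩) fun h1 =>
      Surely.ite (fun h2 => Surely.skip ⟨hold (Or.inr (ha ▸ h2)), hc'⟩) fun h2 => Surely.store ?_
    rw [hs] at h1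
    rw [ha] at h2
    rw [eval_statusAt hf hi, eval_lit hf (by omega)]
    refine ⟨?_, hc⟩
    convert hm.set_status hf i w2 using 1
    funext x
    by_cases hx : x = i
    · subst hx
      rw [Function.update_self, if_pos ⟨by omega, h1, h2⟩]
    · have : (x : ℕ) ≠ i := fun e => hx (Fin.ext e)
      have e : (x : ℕ) < i + 1 ↔ (x : ℕ) < i := by omega
      simp only [Function.update_of_ne hx, e]
  · rintro m'' ⟨hm'', hci⟩
    refine Surely.store ?_
    have hi' : (Expr.read counterAt).eval n 0 0 m'' = i := by
      rw [Expr.eval, eval_counterAt hf, hci]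
    rw [eval_auxAt hf hi', eval_lit hf (by omega)]
    convert hm''.set_aux hf i (x := 0) (by omega) using 1
    funext x
    by_cases hx : x = i
    · subst hx
      rw [Function.update_self, if_pos (by omega)]
    · have : (x : ℕ) ≠ i := fun e => hx (Fin.ext e)
      have e : (x : ℕ) < i + 1 ↔ (x : ℕ) < i := by omega
      simp only [Function.update_of_ne hx, e]

/-! The pass that settles the neighbours of the pivots. -/

open Classical in
/-- The statuses after the pivots have settled their neighbours in the relation `D`. -/
noncomputable def settled (T : Fin n → ℕ) (D : Fin n → Fin n → Prop) (x : Fin n) : ℕ :=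
  if T x = 0 ∧ ∃ p, D p x ∧ T p = 2 then 1 else T x

theorem settled_eq_two {D : Fin n → Fin n → Prop} {x : Fin n} : settled T D x = 2 ↔ T x = 2 := by
  rw [settled]
  split_ifs with h
  · rw [h.1]; simp
  · rfl

theorem surely_settle (hf : Fits S w n) {u v : ℕ} {x y : Expr} {a b : Fin n}
    (hx : x.eval n u v m = a) (hy : y.eval n u v m = b) {D : Fin n → Fin n → Prop}
    (h : Holds m R (settled T D) A) :
    Surely ((settle x y).run n u v m)
      fun m' => Holds m' R (settled T fun p q => D p q ∨ (p = a ∧ q = b)) A := by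
  classical
  have w1 : 1 < 2 ^ w := by have := hf.width; omega
  have hcongr : ∀ {q}, (q ≠ b ∨ T a ≠ 2 ∨ settled T D b ≠ 0) →
      settled T (fun p q => D p q ∨ (p = a ∧ q = b)) q = settled T D q := by
    intro q hq
    by_cases hqb : q = b
    · subst hqb
      unfold settled
      by_cases hT : T q = 0
      · by_cases hD : ∃ p, D p q ∧ T p = 2
        · obtain ⟨p, h1, h2⟩ := hD
          rw [if_pos ⟨hT, p, Or.inl h1, h2⟩, if_pos ⟨hT, p, h1, h2⟩]
        · have ha : T a ≠ 2 := by
            rcases hq with h | h | h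
            · exact absurd rfl h
            · exact h
            · rw [settled, if_neg fun h' => hD h'.2] at h
              exact absurd hT h
          rw [if_neg, if_neg fun h' => hD h'.2]
          rintro ⟨-, p, h1 | ⟨rfl, -⟩, h2⟩
          · exact hD ⟨p, h1, h2⟩
          · exact ha h2
      · rw [if_neg (by tauto), if_neg (by tauto)]
    · unfold settled
      simp [hqb]
  refine Surely.ite (fun h1 => Surely.ite (fun h2 => Surely.skip ?_) fun h2 => Surely.store ?_)
    fun h1 => Surely.skip ?_
  · rw [h.eval_status hf hy] at h2
    convert h using 1
    exact funext fun q => hcongr (Or.inr (Or.inr h2))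
  · rw [eval_eq_ne_zero hf, h.eval_status hf hx, eval_lit hf (by omega), settled_eq_two] at h1
    rw [h.eval_status hf hy] at h2
    rw [eval_statusAt hf hy, eval_lit hf (by omega)]
    convert h.set_status hf b w1 using 1
    funext q
    by_cases hq : q = b
    · subst hq
      have hT : T q = 0 := by
        unfold settled at h2
        split_ifs at h2
        exact h2
      rw [Function.update_self, settled, if_pos ⟨hT, a, Or.inr ⟨rfl, rfl⟩, h1⟩]
    · rw [Function.update_of_ne hq, hcongr (Or.inl hq)]
  · have h1 : T a ≠ 2 := by
      intro e
      refine absurd h1 ((eval_eq_ne_zero hf).2 ?_)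
      rw [h.eval_status hf hx, eval_lit hf (by omega), settled_eq_two, e]
    convert h using 1
    exact funext fun q => hcongr (Or.inr (Or.inl h1))

theorem surely_settlePass_onEdge (hf : Fits S w n) {l : List (Fin n × Fin n)} {a b : Fin n}
    (h : Holds m R (settled T (Seen l)) A) :
    Surely (settlePass.onEdge.run n a b m)
      fun m' => Holds m' R (settled T (Seen (l ++ [(a, b)]))) A := by
  refine Surely.seq (surely_settle hf (eval_src hf a) (eval_dst hf b) h) fun m' h' =>
    (surely_settle hf (eval_dst hf b) (eval_src hf a) h').mono fun m'' h'' => ?_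
  rw [seen_append_eq]
  exact h''

/-! The pass that forms the clusters. -/

/-- `A` records for each vertex `x` the vertex of smallest rank, plus one, among the neighbours of `x`
in the relation `D` that are pivots or unsettled. -/
def Recorded (R T : Fin n → ℕ) (D : Fin n → Fin n → Prop) (A : Fin n → ℕ) : Prop :=
  ∀ x, (A x = 0 ∧ ∀ y, D x y → T y = 1) ∨
    ∃ y : Fin n, A x = y + 1 ∧ D x y ∧ T y ≠ 1 ∧ ∀ z, D x z → T z ≠ 1 → R y ≤ R z

theorem surely_record (hf : Fits S w n) {u v : ℕ} {x y : Expr} {a b : Fin n}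
    (hx : x.eval n u v m = a) (hy : y.eval n u v m = b) {D : Fin n → Fin n → Prop}
    (h : ∃ A, Holds m R T A ∧ Recorded R T D A) :
    Surely ((record x y).run n u v m) fun m' =>
      ∃ A, Holds m' R T A ∧ Recorded R T (fun p q => D p q ∨ (p = a ∧ q = b)) A := by
  obtain ⟨A, h, hA⟩ := h
  have wb : (b : ℕ) + 1 < 2 ^ w := by have := hf.width; omega
  have hst : (Expr.add y (.lit 1)).eval n u v m = b + 1 := by
    rw [Expr.eval, hy, eval_lit hf (by omega), Nat.mod_eq_of_lt wb]
  -- Vertices other than `a` are not affected.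
  have hother : ∀ q, q ≠ a → ∀ A' : Fin n → ℕ, A' q = A q →
      (A' q = 0 ∧ ∀ y, D q y ∨ (q = a ∧ y = b) → T y = 1) ∨
      ∃ y : Fin n, A' q = y + 1 ∧ (D q y ∨ (q = a ∧ y = b)) ∧ T y ≠ 1 ∧
        ∀ z, D q z ∨ (q = a ∧ z = b) → T z ≠ 1 → R y ≤ R z := by
    intro q hq A' hA'
    rw [hA']
    simpa [hq] using hA q
  have hskip : (∀ q : Fin n, q = a → (A q = 0 ∧ ∀ y, D q y ∨ (q = a ∧ y = b) → T y = 1) ∨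
      ∃ y : Fin n, A q = y + 1 ∧ (D q y ∨ (q = a ∧ y = b)) ∧ T y ≠ 1 ∧
        ∀ z, D q z ∨ (q = a ∧ z = b) → T z ≠ 1 → R y ≤ R z) →
      ∃ A, Holds m R T A ∧ Recorded R T (fun p q => D p q ∨ (p = a ∧ q = b)) A := by
    intro ha
    refine ⟨A, h, fun q => ?_⟩
    by_cases hq : q = a
    · exact ha q hq
    · exact hother q hq A rfl
  have hstore : T b ≠ 1 → (∀ z, D a z → T z ≠ 1 → R b ≤ R z) →
      Surely ((Cmd.store (auxAt x) (.add y (.lit 1))).run n u v m) fun m' =>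
      ∃ A, Holds m' R T A ∧ Recorded R T (fun p q => D p q ∨ (p = a ∧ q = b)) A := by
    intro hb hmin
    refine Surely.store ?_
    rw [eval_auxAt hf hx, hst]
    refine ⟨_, h.set_aux hf a wb, fun q => ?_⟩
    by_cases hq : q = a
    · subst hq
      refine Or.inr ⟨b, by rw [Function.update_self], Or.inr ⟨rfl, rfl⟩, hb, ?_⟩
      rintro z (hz | ⟨-, rfl⟩) hz1
      · exact hmin z hz hz1
      · exact le_rfl
    · exact hother q hq _ (Function.update_of_ne hq _ _)
  have hb : T b ≠ 1 ↔ (Expr.eq (.read (statusAt y)) (.lit 1)).eval n u v m = 0 := by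
    rw [← not_iff_not, ne_eq, not_not, ← ne_eq, eval_eq_ne_zero hf, h.eval_status hf hy,
      eval_lit hf (by omega)]
  refine Surely.ite (fun h1 => Surely.skip (hskip ?_)) fun h1 =>
    Surely.ite (fun h2 => Surely.ite (fun h3 => ?_) fun h3 => Surely.skip (hskip ?_)) fun h2 => ?_
  · rintro q rfl
    have hTb : T b = 1 := by
      by_contra hne
      exact h1 (hb.1 hne)
    rcases hA q with ⟨h2, h3⟩ | ⟨y, h2, h3, h4, h5⟩
    · refine Or.inl ⟨h2, ?_⟩
      rintro z (hz | ⟨-, rfl⟩)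
      exacts [h3 z hz, hTb]
    · refine Or.inr ⟨y, h2, Or.inl h3, h4, ?_⟩
      rintro z (hz | ⟨-, rfl⟩) hz1
      exacts [h5 z hz hz1, absurd hTb hz1]
  · rw [h.eval_aux hf hx] at h2
    obtain ⟨c, hc, -, -, hmin⟩ := (hA a).resolve_left fun h' => h2 h'.1
    rw [eval_lt_ne_zero hf, h.eval_rank hf hy, h.eval_rank hf (k := c)] at h3
    · exact hstore (hb.2 h1) fun z hz hz1 => h3.le.trans (hmin z hz hz1)
    · rw [Expr.eval, h.eval_aux hf hx, eval_lit hf (by omega), hc]; omega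
  · rintro q rfl
    rw [h.eval_aux hf hx] at h2
    obtain ⟨c, hc, hD, hT, hmin⟩ := (hA q).resolve_left fun h' => h2 h'.1
    refine Or.inr ⟨c, hc, Or.inl hD, hT, ?_⟩
    rintro z (hz | ⟨-, rfl⟩) hz1
    · exact hmin z hz hz1
    · by_contra hlt
      refine absurd h3 ((eval_lt_ne_zero hf).2 ?_)
      rw [h.eval_rank hf hy, h.eval_rank hf (k := c)]
      · exact not_le.1 hlt
      · rw [Expr.eval, h.eval_aux hf hx, eval_lit hf (by omega), hc]; omega
  · rw [h.eval_aux hf hx] at h2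
    have := (hA a).resolve_right (by rintro ⟨y, hy, -⟩; omega)
    exact hstore (hb.2 h1) fun z hz hz1 => absurd (this.2 z hz) hz1

theorem surely_clusterPass_onEdge (hf : Fits S w n) {l : List (Fin n × Fin n)} {a b : Fin n}
    (h : ∃ A, Holds m R T A ∧ Recorded R T (Seen l) A) :
    Surely (clusterPass.onEdge.run n a b m)
      fun m' => ∃ A, Holds m' R T A ∧ Recorded R T (Seen (l ++ [(a, b)])) A := by
  refine Surely.seq (surely_record hf (eval_src hf a) (eval_dst hf b) h) fun m' h' =>
    (surely_record hf (eval_dst hf b) (eval_src hf a) h').mono fun m'' => ?_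
  rintro ⟨A, h'', hA⟩
  rw [seen_append_eq]
  exact ⟨A, h'', hA⟩

theorem surely_clusterPass_atEnd (hf : Fits S w n) (h : Holds m R T A) (L : Fin n → Fin n)
    (h1 : ∀ x, T x = 2 → L x = x) (h2 : ∀ x, A x = 0 → L x = x)
    (h3 : ∀ x, T x ≠ 2 → A x ≠ 0 → ∃ y : Fin n, A x = y + 1 ∧ L x = if T y = 2 then y else x) :
    Surely (clusterPass.atEnd.run n 0 0 m) fun m' => ∀ x : Fin n, m'.get x = L x := by
  have := Surely.loop (n := n) (u := 0) (v := 0) (m := m) (c := labelStep)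
    (fun i m' => Holds m' R T A ∧ ∀ x : Fin n, (x : ℕ) < i → m'.get x = L x)
    (eval_order hf) (eval_counterAt hf) ⟨h, fun x hx => absurd hx (Nat.not_lt_zero _)⟩ ?_
  · exact this.mono fun m' hm' x => hm'.2 x x.2
  rintro i hi m' ⟨hm', hL⟩
  lift i to Fin n using hi
  have hm := hm'.set_extra (x := i) (le_refl (4 * n))
  have hi := eval_counter (u := 0) (v := 0) (m := m') hf i
  have hs := (hm.eval_status hf hi)
  have ha := (hm.eval_aux hf hi)
  have fin : ∀ {e : Expr} {y : Fin n}, e.eval n 0 0 (m'.set (4 * n) i) = y → L i = y →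
      Surely ((Cmd.store (.read counterAt) e).run n 0 0 (m'.set (4 * n) i)) fun m' =>
        Holds m' R T A ∧ ∀ x : Fin n, (x : ℕ) < i + 1 → m'.get x = L x := by
    intro e y he hy
    refine Surely.store ?_
    have hw := hf.width
    have hc := hf.cells
    rw [hi, he]
    refine ⟨hm.set_label i.2, fun x hx => ?_⟩
    by_cases hxi : x = i
    · subst hxi
      rw [Mem.get_set_self (by omega) (by omega), hy]
    · have : (x : ℕ) ≠ i := fun e => hxi (Fin.ext e)
      rw [Mem.get_set_of_ne this, Mem.get_set_of_ne (by omega), hL x (by omega)]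
  refine Surely.ite (fun e1 => ?_) fun e1 => Surely.ite (fun e2 => Surely.ite (fun e3 => ?_)
    fun e3 => ?_) fun e2 => ?_
  · rw [eval_eq_ne_zero hf, hs, eval_lit hf (by omega)] at e1
    exact fin hi (h1 i e1)
  all_goals
    have e1 : T i ≠ 2 := by
      intro e
      refine absurd e1 ((eval_eq_ne_zero hf).2 ?_)
      rw [hs, eval_lit hf (by omega), e]
    rw [ha] at e2
  · obtain ⟨y, hy, hLy⟩ := h3 i e1 e2
    have hev : (Expr.sub (.read (auxAt (.read counterAt))) (.lit 1)).eval n 0 0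
        (m'.set (4 * n) i) = y := by
      rw [Expr.eval, ha, hy, eval_lit hf (by omega)]; omega
    rw [eval_eq_ne_zero hf, hm.eval_status hf hev, eval_lit hf (by omega)] at e3
    exact fin hev (by rw [hLy, if_pos e3])
  · obtain ⟨y, hy, hLy⟩ := h3 i e1 e2
    have hev : (Expr.sub (.read (auxAt (.read counterAt))) (.lit 1)).eval n 0 0
        (m'.set (4 * n) i) = y := by
      rw [Expr.eval, ha, hy, eval_lit hf (by omega)]; omega
    refine fin hi ?_
    rw [hLy, if_neg]
    intro e
    refine absurd e3 ((eval_eq_ne_zero hf).2 ?_)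
    rw [hm.eval_status hf hev, e, eval_lit hf (by omega)]
  · exact fin hi (h2 i e2)

end Passes

/-! ### The simulation of the rounds -/

section Simulation

variable {S w n : ℕ} {m : Mem S w} {G : SimpleGraph (Fin n)} {π : Equiv.Perm (Fin n)}
  {l : List (Fin n × Fin n)} {r t : ℕ}

theorem IsStream.seen_iff (hl : IsStream G l) {x y : Fin n} : Seen l x y ↔ G.Adj x y := by
  rw [← SimpleGraph.mem_edgeSet, ← hl.2, List.mem_map]
  constructor
  · rintro (h | h)
    · exact ⟨_, h, rfl⟩
    · exact ⟨_, h, Sym2.eq_swap⟩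
  · rintro ⟨⟨a, b⟩, h, he⟩
    rcases Sym2.eq_iff.1 he with ⟨rfl, rfl⟩ | ⟨rfl, rfl⟩
    exacts [Or.inl h, Or.inr h]

theorem IsStream.ne (hl : IsStream G l) {e : Fin n × Fin n} (he : e ∈ l) : e.1 ≠ e.2 :=
  (hl.seen_iff.1 (Or.inl he)).ne

/-- The rank table of a permutation. -/
def rankOf (π : Equiv.Perm (Fin n)) (v : Fin n) : ℕ := π v

theorem rankOf_injective (π : Equiv.Perm (Fin n)) : (rankOf π).Injective :=
  Fin.val_injective.comp π.injective

open Classical in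
/-- The status table of a state of the algorithm. -/
noncomputable def statusOf (s : PivotState n) (v : Fin n) : ℕ :=
  if v ∈ s.pivots then 2 else if v ∈ s.unsettled then 0 else 1

theorem statusOf_eq_two {s : PivotState n} {v : Fin n} : statusOf s v = 2 ↔ v ∈ s.pivots := by
  unfold statusOf
  split_ifs with h1 h2 <;> simp [h1]

theorem statusOf_eq_zero {s : PivotState n} {v : Fin n} :
    statusOf s v = 0 ↔ v ∉ s.pivots ∧ v ∈ s.unsettled := by
  unfold statusOf
  split_ifs with h1 h2 <;> simp [*]

theorem statusOf_eq_one {s : PivotState n} {v : Fin n} :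
    statusOf s v = 1 ↔ v ∉ s.pivots ∧ v ∉ s.unsettled := by
  unfold statusOf
  split_ifs with h1 h2 <;> simp [*]

theorem statusOf_eq_zero' {s : PivotState n} (hs : StateInv G π s) {v : Fin n} :
    statusOf s v = 0 ↔ v ∈ s.unsettled :=
  statusOf_eq_zero.trans ⟨fun h => h.2, fun h => ⟨hs.not_mem v h, h⟩⟩

/-- The tables that the two passes of a round compute are those of the next state. -/
theorem settled_statusOf (hl : IsStream G l) {s : PivotState n} (hs : StateInv G π s)
    {A : Fin n → ℕ} (hA : Flagged (rankOf π) (statusOf s) l A) :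
    settled (fun x => if statusOf s x = 0 ∧ A x = 0 then 2 else statusOf s x) (Seen l) =
      statusOf (pivotRound G π s) := by
  have hnew : ∀ x, (statusOf s x = 0 ∧ A x = 0) ↔ x ∈ newPivots G π s := by
    intro x
    rw [statusOf_eq_zero' hs]
    refine and_congr_right fun hx => ?_
    rw [← not_iff_not, ← ne_eq, hA x]
    push Not
    refine exists_congr fun y => ?_
    rw [statusOf_eq_zero' hs, statusOf_eq_zero' hs, hl.seen_iff]
    constructor
    · rintro ⟨h1, -, h2, h3⟩
      exact ⟨h2, h1, le_of_lt h3⟩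
    · rintro ⟨h1, h2, h3⟩
      exact ⟨h2, hx, h1, lt_of_le_of_ne h3 fun e => h2.ne (π.injective (Fin.ext e)).symm⟩
  have h2 : ∀ x, (if statusOf s x = 0 ∧ A x = 0 then 2 else statusOf s x) = 2 ↔
      x ∈ s.pivots ∪ newPivots G π s := by
    intro x
    rw [Set.mem_union]
    split_ifs with h
    · simp [(hnew x).1 h]
    · rw [statusOf_eq_two, hnew] at *
      tauto
  have h0 : ∀ x, (if statusOf s x = 0 ∧ A x = 0 then 2 else statusOf s x) = 0 ↔
      x ∈ s.unsettled ∧ x ∉ newPivots G π s := by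
    intro x
    rw [← hnew x, ← statusOf_eq_zero' hs]
    split_ifs with h
    · simp [h]
    · tauto
  funext x
  unfold settled
  beta_reduce
  have hpr : (pivotRound G π s).pivots = s.pivots ∪ newPivots G π s := rfl
  by_cases hx : x ∈ s.unsettled ∧ x ∉ newPivots G π s
  · have hx2 : x ∉ s.pivots ∪ newPivots G π s := fun h => h.elim (hs.not_mem x hx.1) hx.2
    by_cases hp : ∃ p ∈ newPivots G π s, G.Adj p x
    · obtain ⟨p, hp, hpx⟩ := hp
      rw [if_pos ⟨(h0 x).2 hx, p, hl.seen_iff.2 hpx, (h2 p).2 (Or.inr hp)⟩, eq_comm,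
        statusOf_eq_one]
      exact ⟨hx2, fun h => h.2.2 p hp hpx⟩
    · rw [if_neg, (h0 x).2 hx, eq_comm, statusOf_eq_zero]
      · exact ⟨hx2, hx.1, hx.2, fun p h1 h2 => hp ⟨p, h1, h2⟩⟩
      · rintro ⟨-, p, hpx, h⟩
        rw [hl.seen_iff] at hpx
        rcases (h2 p).1 h with h | h
        · exact hs.not_adj x hx.1 p h hpx
        · exact hp ⟨p, h, hpx⟩
  · rw [if_neg fun h => hx ((h0 x).1 h.1)]
    by_cases hx2 : x ∈ s.pivots ∪ newPivots G π s
    · rw [(h2 x).2 hx2, eq_comm, statusOf_eq_two, hpr]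
      exact hx2
    · rw [if_neg fun h => hx2 (Or.inr ((hnew x).1 h)), statusOf_eq_one.2, eq_comm, statusOf_eq_one]
      · exact ⟨hx2, fun h => hx ⟨h.1, h.2.1⟩⟩
      · exact ⟨fun h => hx2 (Or.inl h), fun h => hx ⟨h, fun h' => hx2 (Or.inr h')⟩⟩

/-- The memory between two rounds. -/
def HoldsState (m : Mem S w) (π : Equiv.Perm (Fin n)) (s : PivotState n) : Prop :=
  Holds m (rankOf π) (statusOf s) fun _ => 0

theorem fits_pivotAlg (r : ℕ) (hn : n ≠ 0) :
    Fits ((pivotAlg r).cells n) ((pivotAlg r).wordBits n) n := by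
  refine ⟨le_rfl, ?_⟩
  have h1 : n < 2 ^ n.size := Nat.lt_size_self n
  have h2 : 2 ^ (pivotAlg r).wordBits n = (2 ^ n.size) ^ 8 := by
    rw [← pow_mul, mul_comm]; rfl
  rw [h2]
  generalize 2 ^ n.size = b at h1
  -- For `n ≥ 1` one has `b ≥ 2`, so that `b ^ 7` absorbs the constant factor.
  have h3 : 2 ^ 7 ≤ b ^ 7 := Nat.pow_le_pow_left (by omega) 7
  calc 4 * n + 4 ≤ 2 ^ 7 * b := by omega
    _ ≤ b ^ 7 * b := Nat.mul_le_mul_right b h3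
    _ = b ^ 8 := by ring

theorem surely_round (hn : n ≠ 0) (hl : IsStream G l) {s : PivotState n} (hs : StateInv G π s)
    {m : (pivotAlg r).Memory n} (hm : HoldsState m π s) :
    Surely (((pivotAlg r).runPass n l findPass m).bind ((pivotAlg r).runPass n l settlePass))
      fun m' => HoldsState m' π (pivotRound G π s) := by
  have hf := fits_pivotAlg r hn
  refine Surely.bind (P := fun m' => ∃ A, Flagged (rankOf π) (statusOf s) l A ∧ Holds m' (rankOf π)
      (fun x => if statusOf s x = 0 ∧ A x = 0 then 2 else statusOf s x) fun _ => 0) ?_ ?_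
  · refine surely_runPass _
      (fun l₁ m' => ∃ A, Holds m' (rankOf π) (statusOf s) A ∧ Flagged (rankOf π) (statusOf s) l₁ A)
      ⟨_, hm, fun x => ?_⟩ ?_ ?_
    · simp [Seen]
    · rintro l₁ ⟨a, b⟩ he m' hm'
      exact surely_findPass_onEdge hf (rankOf_injective π) (hl.ne he) hm'
    · rintro m' ⟨A, h1, h2⟩
      exact (surely_findPass_atEnd hf h1).mono fun m'' h => ⟨A, h2, h⟩
  · rintro m' ⟨A, hA, hm'⟩
    refine surely_runPass _ (fun l₁ m' => Holds m' (rankOf π) (settled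
      (fun x => if statusOf s x = 0 ∧ A x = 0 then 2 else statusOf s x) (Seen l₁)) fun _ => 0)
      ?_ ?_ ?_
    · convert hm' using 1
      funext x
      simp [settled, Seen]
    · rintro l₁ ⟨a, b⟩ - m'' h
      exact surely_settlePass_onEdge hf h
    · intro m'' h
      refine Surely.skip ?_
      rw [settled_statusOf hl hs hA] at h
      exact h

theorem getElem?_passes_even (ht : t < r) : (pivotAlg r).passes[2 * t]? = some findPass := by
  simp only [pivotAlg]
  rw [List.getElem?_append_left (by simpa using ht)]
  simp [ht]

theorem getElem?_passes_odd (ht : t < r) : (pivotAlg r).passes[2 * t + 1]? = some settlePass := by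
  simp only [pivotAlg]
  rw [List.getElem?_append_left (by simp; omega)]
  have : 2 * t + 1 < 2 * r := by omega
  simp [this, Nat.add_mod]

theorem getElem?_passes_last : (pivotAlg r).passes[2 * r]? = some clusterPass := by
  simp only [pivotAlg]
  rw [List.getElem?_append_right (by simp)]
  simp

theorem runPasses_succ (B : StreamAlg) {k : ℕ} {P : Pass} (h : B.passes[k]? = some P)
    (m : B.Memory n) :
    B.runPasses n l (k + 1) m = (B.runPasses n l k m).bind (B.runPass n l P) := by
  rw [StreamAlg.runPasses, List.take_add_one, h, List.foldl_append]
  rfl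

theorem surely_runPasses (hn : n ≠ 0) (hl : IsStream G l) {m : (pivotAlg r).Memory n}
    (hm : HoldsState m π (pivotState G π 0)) (ht : t ≤ r) :
    Surely ((pivotAlg r).runPasses n l (2 * t) m) fun m' => HoldsState m' π (pivotState G π t) := by
  induction t with
  | zero => exact Surely.pure hm
  | succ t ih =>
    change Surely ((pivotAlg r).runPasses n l (2 * t + 1 + 1) m) _
    rw [runPasses_succ _ (getElem?_passes_odd ht),
      runPasses_succ _ (getElem?_passes_even ht), PMF.bind_bind, pivotState_succ]
    exact Surely.bind (ih (by omega)) fun m' h => surely_round hn hl (stateInv G π t) h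

theorem surely_output (hn : n ≠ 0) (hl : IsStream G l) {m : (pivotAlg r).Memory n}
    (hm : HoldsState m π (pivotState G π 0)) :
    Surely ((pivotAlg r).runPasses n l (2 * r + 1) m)
      fun m' => (pivotAlg r).output m' = rPivot r G π := by
  have hf := fits_pivotAlg r hn
  rw [runPasses_succ _ getElem?_passes_last]
  refine Surely.bind (surely_runPasses hn hl hm le_rfl) fun m₁ h₁ => ?_
  have hs := stateInv G π r
  set s := pivotState G π r with hsdef
  refine surely_runPass _ (fun l₁ m' => ∃ A, Holds m' (rankOf π) (statusOf s) A ∧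
    Recorded (rankOf π) (statusOf s) (Seen l₁) A) ⟨_, h₁, fun x => Or.inl ⟨rfl, ?_⟩⟩ ?_ ?_
  · simp [Seen]
  · rintro l₁ ⟨a, b⟩ - m' hm'
    exact surely_clusterPass_onEdge hf hm'
  · rintro m₂ ⟨A, h₂, hA⟩
    refine (surely_clusterPass_atEnd hf h₂ (clusterHead G π s) ?_ ?_ ?_).mono ?_
    · intro x hx
      exact clusterHead_of_not_joins fun ⟨y, hy⟩ => hy.1 (statusOf_eq_two.1 hx)
    · intro x hx
      refine clusterHead_of_not_joins ?_
      rintro ⟨y, -, hy, hadj, -⟩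
      rcases hA x with ⟨-, h⟩ | ⟨z, hz, -⟩
      · have := h y (hl.seen_iff.2 hadj)
        rw [statusOf_eq_two.2 hy] at this
        omega
      · omega
    · intro x hx hAx
      obtain ⟨y, hy, hxy, hy1, hmin⟩ := (hA x).resolve_left fun h => hAx h.1
      refine ⟨y, hy, ?_⟩
      rw [hl.seen_iff] at hxy
      have hmin' : ∀ z, G.Adj x z → (z ∈ s.pivots ∨ z ∈ s.unsettled) → π y ≤ π z := by
        intro z hz h
        refine hmin z (hl.seen_iff.2 hz) fun h1 => ?_
        rw [statusOf_eq_one] at h1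
        tauto
      split_ifs with h2
      · rw [statusOf_eq_two] at h2
        refine clusterHead_of_joins ⟨fun h => hx (statusOf_eq_two.2 h), h2, hxy, fun p hp ha =>
          hmin' p ha (Or.inl hp), ?_⟩
        rintro ⟨z, hz, hxz, hlt⟩
        exact absurd (hlt y h2 hxy) (not_lt.2 (hmin' z hxz (Or.inr hz)))
      · refine clusterHead_of_not_joins ?_
        rintro ⟨p, -, hp, hadj, hpm, hno⟩
        have hy2 : y ∉ s.pivots := fun h => h2 (statusOf_eq_two.2 h)
        have hyu : y ∈ s.unsettled := by
          by_contra hyu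
          exact hy1 (statusOf_eq_one.2 ⟨hy2, hyu⟩)
        refine hno ⟨y, hyu, hxy, fun q hq ha => lt_of_le_of_ne (hmin' q ha (Or.inl hq)) fun e => ?_⟩
        exact hy2 (π.injective e ▸ hq)
    · intro m' h
      ext a b
      change m'.get a = m'.get b ↔ clusterHead G π s a = clusterHead G π s b
      rw [h, h]
      exact Fin.val_inj

end Simulation

/-! ### The random permutation -/

section Shuffle

variable {n : ℕ}

/-- One step of the Fisher-Yates shuffle: the entry `i` is exchanged with a uniformly random entry
`j ≤ i`. -/
noncomputable def shuffle (n i : ℕ) (π : Equiv.Perm (Fin n)) : PMF (Equiv.Perm (Fin n)) :=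
  if h : i < n then (PMF.uniformOfFintype (Fin (i + 1))).bind fun j =>
    PMF.pure (π * Equiv.swap ⟨i, h⟩ ⟨j, by omega⟩) else PMF.pure π

/-- A permutation that fixes all entries after `k` arises from exactly one permutation fixing the
entries from `k` on by an exchange of the entry `k` with an entry that does not come after it. -/
theorem sum_swap_fixes {k : ℕ} (hk : k < n) (σ : Equiv.Perm (Fin n)) :
    (∑ j : Fin (k + 1), if ∀ i : Fin n, k ≤ i → (σ * Equiv.swap (⟨k, hk⟩ : Fin n) ⟨j, by omega⟩) i = i
      then 1 else 0) = if ∀ i : Fin n, k + 1 ≤ i → σ i = i then 1 else 0 := by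
  have key : ∀ j : Fin (k + 1),
      (∀ i : Fin n, k ≤ i → (σ * Equiv.swap (⟨k, hk⟩ : Fin n) ⟨j, by omega⟩) i = i) ↔
        (∀ i : Fin n, k + 1 ≤ i → σ i = i) ∧ σ ⟨j, by omega⟩ = ⟨k, hk⟩ := by
    intro j
    constructor
    · intro h
      refine ⟨fun i hi => ?_, by simpa using h ⟨k, hk⟩ le_rfl⟩
      have := h i (by omega)
      rwa [Equiv.Perm.mul_apply, Equiv.swap_apply_of_ne_of_ne (by rintro rfl; simp at hi)
        (by rintro rfl; simp at hi; omega)] at this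
    · rintro ⟨h1, h2⟩ i hi
      by_cases hik : i = ⟨k, hk⟩
      · subst hik
        simpa using h2
      · have : (i : ℕ) ≠ k := fun e => hik (Fin.ext e)
        rw [Equiv.Perm.mul_apply, Equiv.swap_apply_of_ne_of_ne hik
          (by rintro rfl; simp at hi this; omega)]
        exact h1 i (by omega)
  simp only [key]
  split_ifs with h
  · have hj : (σ.symm ⟨k, hk⟩ : ℕ) < k + 1 := by
      by_contra hlt
      have h1 := h (σ.symm ⟨k, hk⟩) (by omega)
      rw [Equiv.apply_symm_apply] at h1
      rw [← h1] at hlt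
      simp at hlt
    rw [Finset.sum_eq_single (⟨(σ.symm ⟨k, hk⟩ : ℕ), hj⟩ : Fin (k + 1))]
    · rw [if_pos]
      exact ⟨h, by simp⟩
    · intro j _ hne
      rw [if_neg]
      rintro ⟨-, h2⟩
      refine hne (Fin.ext ?_)
      have := congrArg σ.symm h2
      rw [Equiv.symm_apply_apply] at this
      exact (congrArg Fin.val this :)
    · simp
  · exact Finset.sum_eq_zero fun j _ => if_neg fun h' => h h'.1

open scoped ENNReal in
theorem shuffle_fold_apply (k : ℕ) (hk : k ≤ n) (σ : Equiv.Perm (Fin n)) :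
    ((List.range k).foldl (fun p i => p.bind (shuffle n i)) (PMF.pure 1)) σ =
      (k.factorial : ℝ≥0∞)⁻¹ * (if ∀ i : Fin n, k ≤ i → σ i = i then 1 else 0 : ℕ) := by
  classical
  induction k generalizing σ with
  | zero =>
    have : σ = 1 ↔ ∀ i : Fin n, σ i = i :=
      ⟨fun h i => by rw [h]; rfl, fun h => Equiv.ext h⟩
    simp [this, PMF.pure_apply]
  | succ k ih =>
    have hk' : k < n := hk
    rw [List.range_succ, List.foldl_append, List.foldl_cons, List.foldl_nil]
    set μ := (List.range k).foldl (fun p i => p.bind (shuffle n i)) (PMF.pure 1)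
    have h1 : μ.bind (shuffle n k) = (PMF.uniformOfFintype (Fin (k + 1))).bind fun j =>
        μ.bind fun π => PMF.pure (π * Equiv.swap ⟨k, hk'⟩ ⟨j, by omega⟩) := by
      rw [PMF.bind_comm]
      congr 1
      funext π
      rw [shuffle, dif_pos hk']
    have h2 : ∀ τ : Equiv.Perm (Fin n), τ * τ = 1 →
        (μ.bind fun π => PMF.pure (π * τ)) σ = μ (σ * τ) := by
      intro τ hτ
      rw [PMF.bind_apply, tsum_eq_single (σ * τ)]
      · rw [mul_assoc, hτ, mul_one, PMF.pure_apply, if_pos rfl, mul_one]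
      · intro π hπ
        rw [PMF.pure_apply, if_neg, mul_zero]
        rintro rfl
        exact hπ (by rw [mul_assoc, hτ, mul_one])
    rw [h1, PMF.bind_apply, tsum_fintype, ← sum_swap_fixes hk', Nat.cast_sum,
      Finset.mul_sum]
    refine Finset.sum_congr rfl fun j _ => ?_
    rw [h2 _ (Equiv.swap_mul_self _ _), ih hk'.le, PMF.uniformOfFintype_apply, Fintype.card_fin,
      ← mul_assoc, Nat.factorial_succ, Nat.cast_mul,
      ENNReal.mul_inv (Or.inr (ENNReal.natCast_ne_top _)) (Or.inl (ENNReal.natCast_ne_top _))]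

/-- The Fisher-Yates shuffle yields a uniformly random permutation. -/
theorem shuffle_fold_eq_uniform (n : ℕ) :
    (List.range n).foldl (fun p i => p.bind (shuffle n i)) (PMF.pure 1) =
      PMF.uniformOfFintype (Equiv.Perm (Fin n)) := by
  ext σ
  rw [shuffle_fold_apply n le_rfl, if_pos fun i hi => absurd i.2 (not_lt.2 hi),
    PMF.uniformOfFintype_apply, Fintype.card_perm, Fintype.card_fin, Nat.cast_one, mul_one]

end Shuffle

section Init

variable {S w n : ℕ} {m : Mem S w} {π : Equiv.Perm (Fin n)}

open Classical in
/-- The permutation whose rank table is held in the memory. -/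
noncomputable def decodePerm (n : ℕ) (m : Mem S w) : Equiv.Perm (Fin n) :=
  if h : ∃ π : Equiv.Perm (Fin n), ∀ v : Fin n, m.get (n + v) = π v then h.choose else 1

theorem Holds.decodePerm_eq {T A : Fin n → ℕ} (h : Holds m (rankOf π) T A) :
    decodePerm n m = π := by
  have hex : ∃ π : Equiv.Perm (Fin n), ∀ v : Fin n, m.get (n + v) = π v := ⟨π, h.rank⟩
  rw [decodePerm, dif_pos hex]
  refine Equiv.ext fun v => Fin.ext ?_
  rw [← hex.choose_spec v, h.rank, rankOf]

/-- The memory during the initialization. -/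
def Ready (m : Mem S w) (π : Equiv.Perm (Fin n)) : Prop :=
  Holds m (rankOf π) (fun _ => 0) fun _ => 0

/-- If the random steps `f i` on the set `I` become the steps `K i` under the map `g`, then so do
their iterations. -/
theorem surely_foldl_and_map_foldl {α β : Type*} {I : α → Prop} {g : α → β} {f : ℕ → α → PMF α}
    {K : ℕ → β → PMF β} (N : ℕ) (hI : ∀ i < N, ∀ a, I a → Surely (f i a) I)
    (hK : ∀ i < N, ∀ a, I a → (f i a).map g = K i (g a)) {p : PMF α} (hp : Surely p I) :
    Surely ((List.range N).foldl (fun p i => p.bind (f i)) p) I ∧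
      ((List.range N).foldl (fun p i => p.bind (f i)) p).map g =
        (List.range N).foldl (fun q i => q.bind (K i)) (p.map g) := by
  induction N with
  | zero => exact ⟨hp, rfl⟩
  | succ N ih =>
    obtain ⟨h1, h2⟩ := ih (fun i hi => hI i (by omega)) (fun i hi => hK i (by omega))
    rw [List.range_succ, List.foldl_append, List.foldl_append, List.foldl_cons, List.foldl_nil,
      List.foldl_cons, List.foldl_nil]
    refine ⟨h1.bind (hI N (by omega)), ?_⟩
    rw [← h2, PMF.map_bind, PMF.bind_map]
    ext b
    rw [PMF.bind_apply, PMF.bind_apply]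
    refine tsum_congr fun a => ?_
    by_cases ha : a ∈ PMF.support ((List.range N).foldl (fun p i => p.bind (f i)) p)
    · rw [hK N (by omega) a (h1 a ha)]; rfl
    · rw [(PMF.apply_eq_zero_iff _ a).2 ha, zero_mul, zero_mul]

theorem rankOf_mul_swap (i j : Fin n) : rankOf (π * Equiv.swap i j) =
    Function.update (Function.update (rankOf π) i (rankOf π j)) j (rankOf π i) := by
  funext v
  unfold rankOf
  by_cases hj : v = j
  · subst hj
    simp
  · rw [Function.update_of_ne hj]
    by_cases hi : v = i
    · subst hi
      simp
    · rw [Function.update_of_ne hi, Equiv.Perm.mul_apply, Equiv.swap_apply_of_ne_of_ne hi hj]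

/-- The exchange of the two entries `i` and `j` of the rank table. -/
theorem surely_exchange (hf : Fits S w n) (h : Ready m π) {i j : Fin n}
    (hi : m.get (4 * n) = i) (hj : m.get (4 * n + 1) = j) :
    Surely ((Cmd.seq (.store bufferAt (.read (rankAt (.read counterAt))))
      (.seq (.store (rankAt (.read counterAt)) (.read (rankAt (.read drawAt))))
        (.store (rankAt (.read drawAt)) (.read bufferAt)))).run n 0 0 m)
      fun m' => Ready m' (π * Equiv.swap i j) := by
  have hw := hf.width
  have hc := hf.cells
  have lt : ∀ v : Fin n, rankOf π v < 2 ^ w := fun v => by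
    have := (π v).2
    unfold rankOf
    omega
  have ei : ∀ {m' : Mem S w}, m'.get (4 * n) = i → (Expr.read counterAt).eval n 0 0 m' = i :=
    fun h => by rw [Expr.eval, eval_counterAt hf, h]
  have ej : ∀ {m' : Mem S w}, m'.get (4 * n + 1) = j → (Expr.read drawAt).eval n 0 0 m' = j :=
    fun h => by rw [Expr.eval, eval_drawAt hf, h]
  have h1 : Holds (m.set (4 * n + 2) (rankOf π i)) (rankOf π) (fun _ => 0) (fun _ => 0) :=
    h.set_extra (by omega)
  have i1 : (m.set (4 * n + 2) (rankOf π i)).get (4 * n) = i := by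
    rw [Mem.get_set_of_ne (by omega), hi]
  have j1 : (m.set (4 * n + 2) (rankOf π i)).get (4 * n + 1) = j := by
    rw [Mem.get_set_of_ne (by omega), hj]
  have b1 : (m.set (4 * n + 2) (rankOf π i)).get (4 * n + 2) = rankOf π i :=
    Mem.get_set_self (by omega) (lt i)
  refine Surely.seq (P := fun m' => m' = m.set (4 * n + 2) (rankOf π i)) (Surely.store ?_) ?_
  · rw [eval_bufferAt hf, h.eval_rank hf (ei hi)]
  rintro m' rfl
  set m₁ := m.set (4 * n + 2) (rankOf π i)
  refine Surely.seq (P := fun m' => m' = m₁.set (n + i) (rankOf π j)) (Surely.store ?_) ?_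
  · rw [eval_rankAt hf (ei i1), h1.eval_rank hf (ej j1)]
  rintro m' rfl
  refine Surely.store ?_
  rw [eval_rankAt hf (k := j), Expr.eval, eval_bufferAt hf, Mem.get_set_of_ne (by omega), b1]
  · unfold Ready
    rw [rankOf_mul_swap]
    exact (h1.set_rank hf i (lt j)).set_rank hf j (lt i)
  · exact ej (by rw [Mem.get_set_of_ne (by omega), j1])

theorem draw_run {u v k : ℕ} {a x : Expr} (hx : x.eval n u v m = k) :
    (Cmd.draw a x).run n u v m = (PMF.uniformOfFintype (Fin (k + 1))).bind
      fun i : Fin (k + 1) => PMF.pure (m.set (a.eval n u v m) (i : ℕ)) := by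
  subst hx
  -- In the definition of `draw` the uniform law is coerced to a law on `ℕ`.
  change PMF.map (fun i : ℕ => m.set (a.eval n u v m) i) (PMF.bind (PMF.uniformOfFintype
    (Fin (x.eval n u v m + 1))) fun b => PMF.pure (b : ℕ)) = _
  rw [PMF.map_bind]
  simp only [PMF.pure_map]

/-- One step of the loop that shuffles the rank table. -/
theorem shuffleStep_run (hf : Fits S w n) (h : Ready m π) {i : ℕ} (hi : i < n) :
    Surely (shuffleStep.run n 0 0 (m.set (4 * n) i)) 
        (fun m' => ∃ π' : Equiv.Perm (Fin n), Ready m' π') ∧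
      (shuffleStep.run n 0 0 (m.set (4 * n) i)).map (decodePerm n) = shuffle n i π := by
  have hw := hf.width
  have hc := hf.cells
  have hm : Ready (m.set (4 * n) i) π := h.set_extra le_rfl
  have key : ∀ j : Fin (i + 1), Surely ((Cmd.seq
      (.store bufferAt (.read (rankAt (.read counterAt))))
      (.seq (.store (rankAt (.read counterAt)) (.read (rankAt (.read drawAt))))
        (.store (rankAt (.read drawAt)) (.read bufferAt)))).run n 0 0
        ((m.set (4 * n) i).set (4 * n + 1) j))
      fun m' => Ready m' (π * Equiv.swap (⟨i, hi⟩ : Fin n) ⟨j, by omega⟩) := by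
    intro j
    refine surely_exchange hf (hm.set_extra (by omega)) ?_ ?_
    · rw [Mem.get_set_of_ne (by omega), Mem.get_set_self (by omega) (by omega)]
    · exact Mem.get_set_self (by omega) (by omega)
  have hev : (Expr.read counterAt).eval n 0 0 (m.set (4 * n) i) = i :=
    eval_counter hf ⟨i, hi⟩
  rw [shuffleStep, Cmd.run, draw_run hev, eval_drawAt hf, PMF.bind_bind]
  simp only [PMF.pure_bind]
  refine ⟨?_, ?_⟩
  · exact Surely.bind (P := fun _ => True) (fun _ _ => trivial) fun j _ =>
      (key j).mono fun m' h => ⟨_, h⟩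
  · rw [PMF.map_bind, shuffle, dif_pos hi]
    congr 1
    funext j
    exact ((key j).mono fun m' h => h.decodePerm_eq).map_eq_pure

theorem surely_fill (hf : Fits S w n) (h0 : ∀ a, m.get a = 0) :
    Surely ((Cmd.loop counterAt .order (.store (rankAt (.read counterAt)) (.read counterAt))).run
      n 0 0 m) fun m' => Ready m' (1 : Equiv.Perm (Fin n)) := by
  have := Surely.loop (n := n) (u := 0) (v := 0) (m := m)
    (c := .store (rankAt (.read counterAt)) (.read counterAt))
    (fun i m' => Holds m' (fun v : Fin n => if (v : ℕ) < i then (v : ℕ) else 0) (fun _ => 0)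
      fun _ => 0) (eval_order hf) (eval_counterAt hf)
    ⟨fun v => by simp [h0], fun v => by simp [h0], fun v => by simp [h0]⟩ ?_
  · refine this.mono fun m' h => ?_
    have e : rankOf (1 : Equiv.Perm (Fin n)) = fun v : Fin n => if (v : ℕ) < n then (v : ℕ) else 0 :=
      funext fun v => (if_pos v.2).symm
    rwa [Ready, e]
  intro i hi m' hm'
  lift i to Fin n using hi
  have hm := hm'.set_extra (x := i) (le_refl (4 * n))
  have hi := eval_counter (u := 0) (v := 0) (m := m') hf i
  refine Surely.store ?_
  rw [eval_rankAt hf hi, hi]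
  convert hm.set_rank hf i (x := i) (by have := hf.width; omega) using 1
  funext v
  by_cases hv : v = i
  · subst hv
    simp
  · have : (v : ℕ) ≠ i := fun e => hv (Fin.ext e)
    have e : (v : ℕ) < i + 1 ↔ (v : ℕ) < i := by omega
    simp only [Function.update_of_ne hv, e]

/-- After the initialization the memory holds a uniformly random permutation. -/
theorem initCmd_run (hf : Fits S w n) (h0 : ∀ a, m.get a = 0) :
    Surely (initCmd.run n 0 0 m) (fun m' => ∃ π : Equiv.Perm (Fin n), Ready m' π) ∧
      (initCmd.run n 0 0 m).map (decodePerm n) = PMF.uniformOfFintype (Equiv.Perm (Fin n)) := by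
  have key : ∀ m' : Mem S w, Ready m' (1 : Equiv.Perm (Fin n)) →
      Surely ((Cmd.loop counterAt .order shuffleStep).run n 0 0 m')
        (fun m' => ∃ π : Equiv.Perm (Fin n), Ready m' π) ∧
      ((Cmd.loop counterAt .order shuffleStep).run n 0 0 m').map (decodePerm n) =
        PMF.uniformOfFintype (Equiv.Perm (Fin n)) := by
    intro m' hm'
    rw [Cmd.run, eval_order hf, eval_counterAt hf, ← shuffle_fold_eq_uniform]
    have := surely_foldl_and_map_foldl (I := fun m' : Mem S w => ∃ π : Equiv.Perm (Fin n), Ready m' π)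
      (g := decodePerm n) (f := fun i m'' => shuffleStep.run n 0 0 (Mem.set m'' (4 * n) i))
      (K := shuffle n) n
      (fun i hi m'' ⟨π, h⟩ => (shuffleStep_run hf h hi).1)
      (fun i hi m'' ⟨π, h⟩ => by rw [(shuffleStep_run hf h hi).2, h.decodePerm_eq])
      (p := PMF.pure m') (Surely.pure ⟨1, hm'⟩)
    rwa [PMF.pure_map, hm'.decodePerm_eq] at this
  have hfill := surely_fill hf h0
  refine ⟨Surely.seq hfill fun m' h => (key m' h).1, ?_⟩
  rw [initCmd, Cmd.run, PMF.map_bind]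
  ext σ
  rw [PMF.bind_apply]
  have : ∀ a, ((Cmd.loop counterAt .order (.store (rankAt (.read counterAt))
      (.read counterAt))).run n 0 0 m) a *
      (((Cmd.loop counterAt .order shuffleStep).run n 0 0 a).map (decodePerm n)) σ =
      ((Cmd.loop counterAt .order (.store (rankAt (.read counterAt))
      (.read counterAt))).run n 0 0 m) a * PMF.uniformOfFintype (Equiv.Perm (Fin n)) σ := by
    intro a
    by_cases ha : a ∈ PMF.support ((Cmd.loop counterAt .order (.store (rankAt (.read counterAt))
      (.read counterAt))).run n 0 0 m)
    · rw [(key a (hfill a ha)).2]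
    · rw [(PMF.apply_eq_zero_iff _ a).2 ha, zero_mul, zero_mul]
  rw [tsum_congr this, ENNReal.tsum_mul_right, PMF.tsum_coe, one_mul]

end Init

/-! ### The properties of the algorithm -/

section Final

open scoped ENNReal

variable {n : ℕ} {G : SimpleGraph (Fin n)} {π : Equiv.Perm (Fin n)} {l : List (Fin n × Fin n)}
  {r : ℕ}

theorem Ready.holdsState {S w : ℕ} {m : Mem S w} (h : Ready m π) (G : SimpleGraph (Fin n)) :
    HoldsState m π (pivotState G π 0) := by
  have e : statusOf (pivotState G π 0) = fun _ => 0 :=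
    funext fun v => statusOf_eq_zero.2 ⟨fun h => h, trivial⟩
  rw [HoldsState, e]
  exact h

theorem start_pivotAlg (hn : n ≠ 0) :
    Surely ((pivotAlg r).start n) (fun m => ∃ π : Equiv.Perm (Fin n), Ready m π) ∧
      ((pivotAlg r).start n).map (decodePerm n) =
        PMF.uniformOfFintype (Equiv.Perm (Fin n)) :=
  initCmd_run (fits_pivotAlg r hn) fun a => by simp [Mem.get]

theorem pmf_eq_of_subsingleton {α : Type*} [Subsingleton α] (p q : PMF α) : p = q := by
  obtain ⟨a, -⟩ := p.support_nonempty
  have h : ∀ p : PMF α, p = PMF.pure a := fun p => by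
    rw [← Surely.map_eq_pure (p := p) (f := id) (b := a) fun b _ => Subsingleton.elim _ _,
      PMF.map_id]
  rw [h p, h q]

theorem length_passes (r : ℕ) : (pivotAlg r).passes.length = 2 * r + 1 := by
  simp [pivotAlg]

/-- The streaming algorithm simulates the truncated Pivot algorithm. -/
theorem simulatesRPivot_pivotAlg (r : ℕ) : SimulatesRPivot (pivotAlg r) r := by
  refine ⟨length_passes r, fun n => ?_⟩
  -- For `n = 0` the words have no bits, and there is nothing to decode.
  rcases eq_or_ne n 0 with rfl | hn
  · refine ⟨fun _ => (1, ⟨Set.univ, ∅⟩), pmf_eq_of_subsingleton _ _, fun G l _ m₀ _ =>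
      ⟨fun t _ m _ => ?_, fun m _ => ?_⟩⟩
    · refine Prod.ext rfl (PivotState.ext ?_ ?_) <;> ext x <;> exact x.elim0
    · ext a
      exact a.elim0
  · refine ⟨fun m => (decodePerm n m, ⟨{v | m.get (n + n + v) = 0}, {v | m.get (n + n + v) = 2}⟩),
      start_pivotAlg hn |>.2, fun G l hl m₀ hm₀ => ?_⟩
    obtain ⟨π, hπ⟩ := (start_pivotAlg hn).1 m₀ hm₀
    have hd : decodePerm n m₀ = π := Holds.decodePerm_eq hπ
    simp only [hd]
    refine ⟨fun t ht m hm => ?_, surely_output hn hl (hπ.holdsState G)⟩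
    have h := surely_runPasses hn hl (hπ.holdsState G) ht m hm
    refine Prod.ext (Holds.decodePerm_eq h) (PivotState.ext ?_ ?_)
    · ext v
      rw [Set.mem_ofPred_eq, h.status, statusOf_eq_zero' (stateInv G π t)]
    · ext v
      rw [Set.mem_ofPred_eq, h.status, statusOf_eq_two]

theorem tsum_bind_mul {α β : Type*} (p : PMF α) (k : α → PMF β) (f : β → ℝ≥0∞) :
    ∑' b, p.bind k b * f b = ∑' a, p a * ∑' b, k a b * f b := by
  simp only [PMF.bind_apply, ← ENNReal.tsum_mul_right, ← ENNReal.tsum_mul_left, mul_assoc]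
  exact ENNReal.tsum_comm

theorem tsum_mul_of_surely {α : Type*} {p : PMF α} {f : α → ℝ≥0∞} {c : ℝ≥0∞}
    (h : Surely p fun a => f a = c) : ∑' a, p a * f a = c := by
  have : ∀ a, p a * f a = p a * c := by
    intro a
    by_cases ha : a ∈ p.support
    · rw [h a ha]
    · rw [(PMF.apply_eq_zero_iff p a).2 ha, zero_mul, zero_mul]
  rw [tsum_congr this, ENNReal.tsum_mul_right, PMF.tsum_coe, one_mul]

/-- The expected cost of the output is the average cost of the truncated algorithm over all
permutations. -/
theorem expectedCost_pivotAlg (hn : n ≠ 0) (hl : IsStream G l) :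
    expectedCost (pivotAlg r) G l =
      (n.factorial : ℝ)⁻¹ * ∑ π : Equiv.Perm (Fin n), (cost G (rPivot r G π) : ℝ) := by
  obtain ⟨h1, h2⟩ := start_pivotAlg (r := r) hn
  have key : ∑ m, (pivotAlg r).run n l m * (cost G ((pivotAlg r).output m) : ℝ≥0∞) =
      (n.factorial : ℝ≥0∞)⁻¹ * ∑ π : Equiv.Perm (Fin n), (cost G (rPivot r G π) : ℝ≥0∞) := by
    rw [← tsum_fintype (L := .unconditional _), StreamAlg.run, tsum_bind_mul]
    have e1 : ∀ m₀, (pivotAlg r).start n m₀ * ∑' m, (pivotAlg r).runPasses n l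
        (pivotAlg r).passes.length m₀ m * (cost G ((pivotAlg r).output m) : ℝ≥0∞) =
        (pivotAlg r).start n m₀ * (cost G (rPivot r G (decodePerm n m₀)) : ℝ≥0∞) := by
      intro m₀
      by_cases hm₀ : m₀ ∈ ((pivotAlg r).start n).support
      · obtain ⟨π, hπ⟩ := h1 m₀ hm₀
        rw [tsum_mul_of_surely (c := (cost G (rPivot r G (decodePerm n m₀)) : ℝ≥0∞))]
        rw [length_passes, Holds.decodePerm_eq hπ]
        exact (surely_output hn hl (hπ.holdsState G)).mono fun m hm => by rw [hm]
      · rw [(PMF.apply_eq_zero_iff _ _).2 hm₀, zero_mul, zero_mul]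
    rw [tsum_congr e1]
    have e2 := tsum_bind_mul ((pivotAlg r).start n) (fun m => PMF.pure (decodePerm n m))
      fun π => (cost G (rPivot r G π) : ℝ≥0∞)
    have e3 : ((pivotAlg r).start n).bind (fun m => PMF.pure (decodePerm n m)) =
        PMF.uniformOfFintype (Equiv.Perm (Fin n)) := h2
    rw [e3] at e2
    have e4 : ∀ m : (pivotAlg r).Memory n, ∑' π, PMF.pure (decodePerm n m) π *
        (cost G (rPivot r G π) : ℝ≥0∞) = cost G (rPivot r G (decodePerm n m)) := fun m =>
      tsum_mul_of_surely (Surely.pure rfl)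
    simp only [e4] at e2
    rw [← e2, tsum_fintype, Finset.mul_sum]
    refine Finset.sum_congr rfl fun π _ => ?_
    rw [PMF.uniformOfFintype_apply, Fintype.card_perm, Fintype.card_fin]
  have h := congrArg ENNReal.toReal key
  rw [ENNReal.toReal_sum fun m _ =>
      ENNReal.mul_ne_top (PMF.apply_ne_top _ _) (ENNReal.natCast_ne_top _),
    ENNReal.toReal_mul, ENNReal.toReal_sum fun π _ => ENNReal.natCast_ne_top _,
    ENNReal.toReal_inv, ENNReal.toReal_natCast] at h
  simp only [ENNReal.toReal_mul, ENNReal.toReal_natCast] at h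
  exact h

/-- The approximation guarantee of the streaming algorithm. -/
theorem expectedCost_pivotAlg_le (hr : 1 ≤ r) (hl : IsStream G l) :
    expectedCost (pivotAlg r) G l ≤ (3 + 6 / r) * (opt G : ℝ) := by
  -- For `n = 0` the words have no bits and the program does not matter.
  rcases eq_or_ne n 0 with rfl | hn
  · have h0 : ∀ c, cost G c = 0 := fun c => by
      have := two_mul_cost (G := G) c
      rw [Finset.univ_eq_empty, Finset.sum_empty] at this
      omega
    have : expectedCost (pivotAlg r) G l = 0 := by
      simp [expectedCost, h0]
    rw [this]
    positivity
  · have h1 := mul_sum_cost_rPivot_le G hr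
    have h2 := Nat.mul_le_mul_left (r + 2) (sum_cost_pivot_le G)
    have h3 := h1.trans h2
    rw [expectedCost_pivotAlg hn hl]
    have h4 : (r : ℝ) * ∑ π : Equiv.Perm (Fin n), (cost G (rPivot r G π) : ℝ) ≤
        (r + 2) * (3 * (n.factorial * (opt G : ℝ))) := by exact_mod_cast h3
    have hr' : (0 : ℝ) < r := by exact_mod_cast hr
    have hn' : (0 : ℝ) < n.factorial := by exact_mod_cast n.factorial_pos
    rw [inv_mul_le_iff₀ hn', ← mul_le_mul_iff_of_pos_left hr']
    refine h4.trans (le_of_eq ?_)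
    field_simp
    ring

theorem words_pivotAlg_le (r : ℕ) : (pivotAlg r).words ≤ 100 := by
  have key : ∀ L : List Pass, (∀ P ∈ L, max P.onEdge.words P.atEnd.words ≤ 100) →
      (L.map fun P => max P.onEdge.words P.atEnd.words).foldr max 0 ≤ 100 := by
    intro L hL
    induction L with
    | nil => simp
    | cons P L ih =>
      simp only [List.map_cons, List.foldr_cons]
      exact max_le (hL P (by simp)) (ih fun Q hQ => hL Q (by simp [hQ]))
  refine max_le (show initCmd.words ≤ 100 by decide) (key _ fun P hP => ?_)
  simp only [pivotAlg, List.mem_append, List.mem_map, List.mem_singleton] at hP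
  rcases hP with ⟨k, -, rfl⟩ | rfl
  · split_ifs <;> decide
  · decide

theorem space_pivotAlg_le (r : ℕ) (hn : 2 ≤ n) :
    ((pivotAlg r).space n : ℝ) ≤ 2000 * (n * Real.log n) := by
  have h1 : (pivotAlg r).space n ≤ (57 * n) * (8 * (2 * Nat.log 2 n)) := by
    have hw := words_pivotAlg_le r
    have hs : n.size ≤ 2 * Nat.log 2 n := by
      have h0 : 1 ≤ Nat.log 2 n := Nat.log_pos (by norm_num) hn
      have : n.size ≤ Nat.log 2 n + 1 := Nat.size_le.2 (Nat.lt_pow_succ_log_self (by norm_num) n)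
      omega
    -- `4 n + 3` cells, three input words and at most `100` temporaries.
    refine Nat.mul_le_mul ?_ (Nat.mul_le_mul_left 8 hs)
    change 4 * n + 3 + 3 + _ ≤ _
    omega
  have h2 : (Nat.log 2 n : ℝ) ≤ Real.log n / Real.log 2 := Real.natLog_le_logb n 2
  have h3 : (0.69 : ℝ) < Real.log 2 := by have := Real.log_two_gt_d9; linarith
  have h4 : 0 ≤ Real.log n := Real.log_natCast_nonneg n
  have h5 : Real.log n / Real.log 2 ≤ 1.5 * Real.log n := by
    rw [div_le_iff₀ (by linarith)]
    nlinarith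
  have h6 : ((pivotAlg r).space n : ℝ) ≤ (57 * n) * (8 * (2 * (Nat.log 2 n : ℝ))) := by
    exact_mod_cast h1
  have hn' : (0 : ℝ) ≤ n := Nat.cast_nonneg n
  have h7 : (n : ℝ) * Nat.log 2 n ≤ n * (1.5 * Real.log n) :=
    mul_le_mul_of_nonneg_left (h2.trans h5) hn'
  nlinarith [mul_nonneg hn' h4]

end Final

end CorrClust

theorem corollary4 :
    ∃ C : ℝ, ∀ ε : ℝ, 0 < ε →
      ∃ (r : ℕ) (A : CorrClust.StreamAlg), 1 ≤ r ∧
        (A.passes.length : ℝ) ≤ C * max 1 (1 / ε) ∧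
        (∀ n : ℕ, 2 ≤ n → (A.space n : ℝ) ≤ C * (n * Real.log n)) ∧
        CorrClust.SimulatesRPivot A r ∧
        ∀ (n : ℕ) (G : SimpleGraph (Fin n)) (l : List (Fin n × Fin n)), CorrClust.IsStream G l →
          CorrClust.expectedCost A G l ≤ (3 + ε) * (CorrClust.opt G : ℝ) := by
  refine ⟨2000, fun ε hε => ?_⟩
  have hr : 1 ≤ ⌈6 / ε⌉₊ := Nat.one_le_ceil_iff.2 (by positivity)
  have hle : 6 / ε ≤ (⌈6 / ε⌉₊ : ℝ) := Nat.le_ceil _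
  refine ⟨⌈6 / ε⌉₊, CorrClust.pivotAlg ⌈6 / ε⌉₊, hr, ?_,
    fun n hn => CorrClust.space_pivotAlg_le _ hn, CorrClust.simulatesRPivot_pivotAlg _,
    fun n G l hl => (CorrClust.expectedCost_pivotAlg_le hr hl).trans ?_⟩
  · rw [CorrClust.length_passes]
    have h1 : (⌈6 / ε⌉₊ : ℝ) < 6 / ε + 1 := Nat.ceil_lt_add_one (by positivity)
    have h2 : 6 / ε = 6 * (1 / ε) := by ring
    have h3 : 1 / ε ≤ max 1 (1 / ε) := le_max_right _ _
    have h4 : 1 ≤ max 1 (1 / ε) := le_max_left _ _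
    push_cast
    linarith
  · refine mul_le_mul_of_nonneg_right ?_ (Nat.cast_nonneg _)
    have hr' : (0 : ℝ) < (⌈6 / ε⌉₊ : ℝ) := by exact_mod_cast hr
    have : 6 / (⌈6 / ε⌉₊ : ℝ) ≤ ε := by
      rw [div_le_iff₀ hr', mul_comm]
      exact (div_le_iff₀ hε).1 hle
    linarith
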